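/- Lemma 2.2. Let $G=(V,E)$ be a finite simple graph with $V=[n]$, and let $P_G\in(\mathbb{R}\cup\{\bot\})^{n\times n}$ be the partial matrix with $P_G(i,j)=1$ if $i=j$, $P_G(i,j)=0$ if $\{i,j\}\in E$, and $P_G(i,j)=\bot$ otherwise; let $\Omega=\{(i,j): P_G(i,j)\neq\bot\}$ be the set of revealed entries. Let $M\in\mathbb{R}^{n\times n}$ be a matrix of rank $r$ and let $c,\epsilon$ be real numbers with $cr\ge 1$ such that \[|M(i,j)|\le c\ \text{ for all } i,j\in[n],\qquad \sum_{(i,j)\in\Omega}\bigl(M(i,j)-P_G(i,j)\bigr)^2\le \epsilon n.\] Then $G$ has an independent set $T$ of size \[|T|\ \ge\ \frac{\bigl(1-4(cr)^2\epsilon\bigr)\,n}{r\sqrt{\pi}\,\bigl(8\sqrt{cr}\bigr)^r}.\] Moreover, there is a randomized polynomial time algorithm for finding such an independent set: there is a single randomized algorithm which, given $G$ and a matrix $M$ with rational entries (in binary), halts on every input and for all outcomes of its coin flips within time polynomial in the bit length of $(G,M)$, and which, whenever $M$ has rank $r$ and satisfies the two conditions above for some $c,\epsilon$ with $cr\ge1$,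 outputs with probability at least $2/3$ an independent set of $G$ whose size is at least the stated bound (for all such $c,\epsilon$). -/

import Mathlib

/-! ## The partial matrix of a graph -/

/-- The partial matrix `P_G` with entries in `ℝ ∪ {⊥}` (`⊥` is `none`): ones on the diagonal,
zeros at the edges, everything else unrevealed. -/
noncomputable def partialMatrix {n : ℕ} (G : SimpleGraph (Fin n)) :
    Matrix (Fin n) (Fin n) (Option ℝ) :=
  open Classical in
  Matrix.of fun i j => if i = j then some 1 else if G.Adj i j then some 0 else none

/-- The set `Ω` of revealed entries of a partial matrix. -/
def revealed {n : ℕ} (P : Matrix (Fin n) (Fin n) (Option ℝ)) : Finset (Fin n × Fin n) :=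
  Finset.univ.filter fun q => (P q.1 q.2).isSome

/-- The squared error of `M` on the revealed entries of `P`
(the default value in `getD` is never used, since the sum runs over revealed entries only). -/
noncomputable def revealedError {n : ℕ} (P : Matrix (Fin n) (Fin n) (Option ℝ))
    (M : Matrix (Fin n) (Fin n) ℝ) : ℝ :=
  ∑ q ∈ revealed P, (M q.1 q.2 - (P q.1 q.2).getD 0) ^ 2

/-- `M` is a rank `r` matrix with entries bounded by `c` in absolute value and with squared error
at most `ε n` on the revealed entries of `P_G`. -/
structure IsApproxCompletion {n : ℕ} (G : SimpleGraph (Fin n)) (M : Matrix (Fin n) (Fin n) ℝ)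
    (r : ℕ) (c ε : ℝ) : Prop where
  rank_eq : M.rank = r
  abs_le : ∀ i j, |M i j| ≤ c
  error_le : revealedError (partialMatrix G) M ≤ ε * n

/-- The guaranteed size of the independent set. -/
noncomputable def indepBound (n r : ℕ) (c ε : ℝ) : ℝ :=
  (1 - 4 * (c * r) ^ 2 * ε) * n / (r * √Real.pi * (8 * √(c * r)) ^ r)

/-! ## Random access machines with logarithmic cost

Structured programs over integer variables and integer arrays. Every operation is charged the
number of bits of the integers it handles, so that running times agree with those of Turing
machines up to a polynomial. -/

namespace LogRAM

/-- A memory: integer variables, named by natural numbers, and integer arrays,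
named by natural numbers and indexed by integers. -/
structure State where
  var : ℕ → ℤ
  arr : ℕ → ℤ → ℤ

/-- Arithmetic expressions. -/
inductive Expr
  | const (z : ℤ)
  | var (x : ℕ)
  | get (a : ℕ) (i : Expr)
  | add (e f : Expr)
  | sub (e f : Expr)
  | mul (e f : Expr)
  | div (e f : Expr)

/-- The value of an expression (`div` is integer division, with value `0` for divisor `0`). -/
def Expr.eval (s : State) : Expr → ℤ
  | .const z => z
  | .var x => s.var x
  | .get a i => s.arr a (i.eval s)
  | .add e f => e.eval s + f.eval s
  | .sub e f => e.eval s - f.eval s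
  | .mul e f => e.eval s * f.eval s
  | .div e f => e.eval s / f.eval s

/-- The bit length of an integer, with one extra bit for the sign. -/
def bits (z : ℤ) : ℕ := z.natAbs.size + 1

/-- The cost of evaluating an expression: the total bit length of the values of all its
subexpressions, array indices included. -/
def Expr.cost (s : State) : Expr → ℕ
  | .const z => bits z
  | .var x => bits (s.var x)
  | .get a i => i.cost s + bits (s.arr a (i.eval s))
  | .add e f => e.cost s + f.cost s + bits (e.eval s + f.eval s)
  | .sub e f => e.cost s + f.cost s + bits (e.eval s - f.eval s)
  | .mul e f => e.cost s + f.cost s + bits (e.eval s * f.eval s)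
  | .div e f => e.cost s + f.cost s + bits (e.eval s / f.eval s)

/-- Programs. A guard `e` of a conditional or of a loop is true when its value is positive. -/
inductive Prog
  | skip
  | assign (x : ℕ) (e : Expr)
  | put (a : ℕ) (i e : Expr)
  | seq (p q : Prog)
  | ite (e : Expr) (p q : Prog)
  | while (e : Expr) (p : Prog)

/-- Assign the value `z` to the variable `x`. -/
def State.setVar (s : State) (x : ℕ) (z : ℤ) : State :=
  { s with var := Function.update s.var x z }

/-- Write the value `z` into the array `a` at index `i`. -/
def State.setArr (s : State) (a : ℕ) (i z : ℤ) : State :=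
  { s with arr := Function.update s.arr a (Function.update (s.arr a) i z) }

/-- `Exec p s s₁ t`: the program `p`, started in the memory `s`, halts in the memory `s₁` after
a computation of cost `t`. -/
inductive Exec : Prog → State → State → ℕ → Prop
  | skip (s : State) : Exec .skip s s 1
  | assign (x : ℕ) (e : Expr) (s : State) :
      Exec (.assign x e) s (s.setVar x (e.eval s)) (e.cost s + 1)
  | put (a : ℕ) (i e : Expr) (s : State) :
      Exec (.put a i e) s (s.setArr a (i.eval s) (e.eval s)) (i.cost s + e.cost s + 1)
  | seq {p q : Prog} {s s₁ s₂ : State} {t₁ t₂ : ℕ} :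
      Exec p s s₁ t₁ → Exec q s₁ s₂ t₂ → Exec (.seq p q) s s₂ (t₁ + t₂)
  | ite_true {e : Expr} {p q : Prog} {s s₁ : State} {t : ℕ} :
      0 < e.eval s → Exec p s s₁ t → Exec (.ite e p q) s s₁ (e.cost s + t + 1)
  | ite_false {e : Expr} {p q : Prog} {s s₁ : State} {t : ℕ} :
      e.eval s ≤ 0 → Exec q s s₁ t → Exec (.ite e p q) s s₁ (e.cost s + t + 1)
  | while_true {e : Expr} {p : Prog} {s s₁ s₂ : State} {t₁ t₂ : ℕ} :
      0 < e.eval s → Exec p s s₁ t₁ → Exec (.while e p) s₁ s₂ t₂ →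
      Exec (.while e p) s s₂ (e.cost s + t₁ + t₂ + 1)
  | while_false {e : Expr} {p : Prog} {s : State} :
      e.eval s ≤ 0 → Exec (.while e p) s s (e.cost s + 1)

/-- The probability of the event `S` under `k` independent fair coin flips. -/
noncomputable def coinProb (k : ℕ) (S : Set (Fin k → Bool)) : ℝ := (S.ncard : ℝ) / 2 ^ k

/-- A randomized polynomial time algorithm for a search problem. Instances `x` have the bit size
`size x`, and `load x w` is the initial memory that holds the instance `x` and a string `w` of
random bits; `Sol x s` says that the final memory `s` holds a solution of `x`. A single program
has to halt on every instance `x` and for all coin flips within time `p (size x)`, using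
`p (size x)` coin flips for a fixed polynomial `p`, and on every instance in `Valid` it has to
find a solution with probability at least `2 / 3`. -/
def RandPolyTimeSolvable {X : Type} (size : X → ℕ)
    (load : X → (k : ℕ) → (Fin k → Bool) → State)
    (Valid : X → Prop) (Sol : X → State → Prop) : Prop :=
  ∃ (prog : Prog) (p : Polynomial ℕ), ∀ x : X,
    (∀ w : Fin (p.eval (size x)) → Bool, ∃ (s : State) (t : ℕ),
      Exec prog (load x _ w) s t ∧ t ≤ p.eval (size x)) ∧
    (Valid x → 2 / 3 ≤ coinProb (p.eval (size x))
      {w | ∃ (s : State) (t : ℕ), Exec prog (load x _ w) s t ∧ Sol x s})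

end LogRAM

/-! ## The computational problem -/

/-- An input of the algorithm: a graph on `n` vertices and a rational `n × n` matrix. -/
structure GraphMatrixInput where
  n : ℕ
  G : SimpleGraph (Fin n)
  M : Matrix (Fin n) (Fin n) ℚ

namespace GraphMatrixInput

/-- The real matrix of an input. -/
def realM (x : GraphMatrixInput) : Matrix (Fin x.n) (Fin x.n) ℝ := x.M.map fun q => (q : ℝ)

/-- The bit size of an input: one bit for each entry of the adjacency matrix, and numerator and
denominator in binary for each entry of the matrix. -/
def size (x : GraphMatrixInput) : ℕ :=
  ∑ i, ∑ j, (1 + LogRAM.bits (x.M i j).num + LogRAM.bits ((x.M i j).den : ℤ))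

/-- The array that stores an `n × n` matrix row by row: entry `(i, j)` at index `i * n + j`,
and zeros elsewhere. -/
def flatten {n : ℕ} (A : Fin n → Fin n → ℤ) (z : ℤ) : ℤ :=
  ∑ i : Fin n, ∑ j : Fin n, if z = (i : ℤ) * n + j then A i j else 0

/-- The initial memory: variable `0` holds `n`, array `0` holds the adjacency matrix, the arrays
`1` and `2` hold the numerators and denominators of the matrix entries, and array `3` holds the
random bits. All other variables and array entries are zero. -/
noncomputable def load (x : GraphMatrixInput) (k : ℕ) (w : Fin k → Bool) : LogRAM.State :=
  open Classical in
  { var := fun v => if v = 0 then (x.n : ℤ) else 0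
    arr := fun a z => match a with
      | 0 => flatten (fun i j => if x.G.Adj i j then 1 else 0) z
      | 1 => flatten (fun i j => (x.M i j).num) z
      | 2 => flatten (fun i j => ((x.M i j).den : ℤ)) z
      | 3 => ∑ l : Fin k, if z = (l : ℤ) ∧ w l = true then 1 else 0
      | _ => 0 }

/-- The set of vertices that a memory holds as output: those `i` with entry `1` at index `i` of
array `4`. -/
def output (x : GraphMatrixInput) (s : LogRAM.State) : Finset (Fin x.n) :=
  Finset.univ.filter fun i => s.arr 4 (i : ℤ) = 1

end GraphMatrixInput

/-! By Markov's inequality all but `4 ε n` vertices are good: the revealed entries of their rows are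
off by less than `1 / 4` in total square. If the good vertices `i` and `j` are adjacent, then
`M i i + M j j - M i j - M j i` is bounded below. Factor `M i j = ∑ q, a i q * b j q` through a
`3 / 2`-approximate barycentric spanner of the rows of `M`, so that `|a| ≤ 3 / 2` and `|b| ≤ c`. The
quantity above is `∑ q, (a i q - a j q) * (b i q - b j q)`, which by AM-GM is small as soon as
`c a i + b i` and `c a j + b j` lie in the same cell of a grid with about `√(c r)` cells per
coordinate. So the good vertices of one cell are independent, and the pigeonhole principle yields a
large cell.

A spanner is found by pivoting in integer arithmetic. Each pivot raises the number of rows in the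
basis or multiplies the absolute value of its determinant by more than `3 / 2`, and the
determinants have polynomially many bits, so polynomially many pivots suffice. The algorithm needs
no coin flips. -/

/-! ## Clustering the good vertices -/

section Clustering

variable {V κ : Type*}

/-- The squared error of `M` on the revealed entries of row `i` of the partial matrix of `G`. -/
noncomputable def rowError [Fintype V] (G : SimpleGraph V) (M : Matrix V V ℝ) (i : V) : ℝ :=
  open Classical in (M i i - 1) ^ 2 + ∑ j with G.Adj i j, M i j ^ 2

/-- The vertices whose row of `M` is close to the revealed entries of the partial matrix. -/
noncomputable def goodSet [Fintype V] (G : SimpleGraph V) (M : Matrix V V ℝ) : Finset V :=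
  open Classical in {i | rowError G M i < 1 / 4}

/-- The members of `S` in the same cell as `k`. -/
def cellClass [DecidableEq (κ → ℤ)] (S : Finset V) (cell : V → κ → ℤ) (k : V) : Finset V :=
  {i ∈ S | cell i = cell k}

/-- The cell of vertex `i` for a factorization `M i j = ∑ q, a i q * b j q` with `|a| ≤ 3 / 2` and
`|b| ≤ μ`: the vectors `μ a i + b i` lie in a cube of side `5 μ`, which is cut into `2 m` parts
along each coordinate. -/
noncomputable def cell (a b : V → κ → ℝ) (μ : ℝ) (m : ℕ) (i : V) (q : κ) : ℤ :=
  ⌊2 * m * (μ * a i q + b i q) / (5 * μ)⌋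

theorem rowError_nonneg [Fintype V] (G : SimpleGraph V) (M : Matrix V V ℝ) (i : V) :
    0 ≤ rowError G M i := by
  unfold rowError
  positivity

theorem sq_add_sq_le_rowError [Fintype V] {G : SimpleGraph V} {M : Matrix V V ℝ} {i j : V}
    (h : G.Adj i j) :
    (M i i - 1) ^ 2 + M i j ^ 2 ≤ rowError G M i := by
  classical
  unfold rowError
  gcongr
  exact Finset.single_le_sum (f := fun j => M i j ^ 2) (fun _ _ => sq_nonneg _) (by simpa using h)

theorem rowError_eq_sum [Fintype V] [DecidableEq V] (G : SimpleGraph V) [DecidableRel G.Adj]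
    (M : Matrix V V ℝ) (i : V) :
    rowError G M i =
      ∑ j, ((if i = j then (M i j - 1) ^ 2 else 0) + if G.Adj i j then M i j ^ 2 else 0) := by
  rw [Finset.sum_add_distrib, Finset.sum_ite_eq, if_pos (Finset.mem_univ i), ← Finset.sum_filter,
    rowError]
  congr!

theorem revealedError_eq_sum_rowError {n : ℕ} (G : SimpleGraph (Fin n))
    (M : Matrix (Fin n) (Fin n) ℝ) :
    revealedError (partialMatrix G) M = ∑ i, rowError G M i := by
  classical
  rw [revealedError, revealed, Finset.sum_filter, Fintype.sum_prod_type]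
  refine Finset.sum_congr rfl fun i _ => ?_
  rw [rowError_eq_sum]
  refine Finset.sum_congr rfl fun j _ => ?_
  by_cases hij : i = j
  · simp [partialMatrix, hij]
  · by_cases hadj : G.Adj i j <;> simp [partialMatrix, hij, hadj]

theorem card_sub_le_card_goodSet [Fintype V] (G : SimpleGraph V) (M : Matrix V V ℝ) :
    (Fintype.card V - 4 * ∑ i, rowError G M i : ℝ) ≤ (goodSet G M).card := by
  classical
  have hbad : (((Finset.univ.filter fun i => ¬ rowError G M i < 1 / 4).card : ℕ) : ℝ) * (1 / 4)
      ≤ ∑ i, rowError G M i := by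
    rw [← nsmul_eq_mul, ← Finset.sum_const]
    refine (Finset.sum_le_sum fun i hi => ?_).trans
      (Finset.sum_le_univ_sum_of_nonneg (rowError_nonneg G M))
    simpa using (Finset.mem_filter.1 hi).2
  have hcard : ((goodSet G M).card : ℝ) +
      ((Finset.univ.filter fun i => ¬ rowError G M i < 1 / 4).card : ℝ) = Fintype.card V :=
    mod_cast Finset.card_filter_add_card_filter_not fun i => rowError G M i < 1 / 4
  linarith

theorem abs_cell_le {a b : V → κ → ℝ} {μ : ℝ} {m : ℕ} {i : V} {q : κ} (ha : |a i q| ≤ 3 / 2)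
    (hb : |b i q| ≤ μ) : |cell a b μ m i q| ≤ m := by
  have hμ : 0 ≤ μ := (abs_nonneg _).trans hb
  obtain ⟨ha₁, ha₂⟩ := abs_le.1 ha
  obtain ⟨hb₁, hb₂⟩ := abs_le.1 hb
  have hlow : -(5 / 2 * μ) ≤ μ * a i q + b i q := by nlinarith
  have hupp : μ * a i q + b i q ≤ 5 / 2 * μ := by nlinarith
  have hm : (0 : ℝ) ≤ 2 * m := by positivity
  refine abs_le.2 ⟨Int.le_floor.2 ?_, Int.cast_le.1 ((Int.floor_le _).trans ?_)⟩ <;> push_cast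
  · rw [neg_le, ← neg_div]
    refine div_le_of_le_mul₀ (by positivity) (by positivity) ?_
    linarith [mul_le_mul_of_nonneg_left hlow hm]
  · refine div_le_of_le_mul₀ (by positivity) (by positivity) ?_
    linarith [mul_le_mul_of_nonneg_left hupp hm]

theorem abs_sub_le_of_cell_eq {a b : V → κ → ℝ} {μ : ℝ} {m : ℕ} {i j : V} {q : κ} (hμ : 0 < μ)
    (hm : 0 < m) (h : cell a b μ m i q = cell a b μ m j q) :
    |(μ * a i q + b i q) - (μ * a j q + b j q)| ≤ 5 * μ / (2 * m) := by
  have : (0 : ℝ) < m := by exact_mod_cast hm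
  have hlt := Int.abs_sub_lt_one_of_floor_eq_floor h
  rw [← sub_div, ← mul_sub, abs_div, abs_mul, abs_of_pos (by positivity : 0 < 5 * μ),
    abs_of_pos (by positivity : (0 : ℝ) < 2 * m), div_lt_one (by positivity)] at hlt
  rw [le_div_iff₀ (by positivity)]
  linarith

theorem sum_mul_sub_le_of_cell_eq [Fintype κ] {a b : V → κ → ℝ} {μ : ℝ} {m : ℕ} {i j : V}
    (hμ : 0 < μ) (hm : 0 < m) (hres : 3 * Fintype.card κ * μ ≤ m ^ 2)
    (h : cell a b μ m i = cell a b μ m j) :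
    ∑ q, (a i q - a j q) * (b i q - b j q) ≤ 25 / 48 := by
  have : (0 : ℝ) < m := by exact_mod_cast hm
  have hterm (q : κ) : (a i q - a j q) * (b i q - b j q) ≤ 25 * μ / (16 * m ^ 2) := by
    -- AM-GM: `x * y ≤ (μ * x + y) ^ 2 / (4 * μ)`
    have hsq := pow_le_pow_left₀ (abs_nonneg _) (abs_sub_le_of_cell_eq hμ hm (congrFun h q)) 2
    rw [sq_abs, div_pow, le_div_iff₀ (by positivity)] at hsq
    rw [le_div_iff₀ (by positivity)]
    refine le_of_mul_le_mul_left ?_ hμ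
    nlinarith [mul_nonneg (sq_nonneg (m : ℝ))
      (sq_nonneg ((μ * a i q - b i q) - (μ * a j q - b j q)))]
  refine (Finset.sum_le_sum fun q _ => hterm q).trans ?_
  rw [Finset.sum_const, Finset.card_univ, nsmul_eq_mul, mul_div_assoc', div_le_iff₀ (by positivity)]
  linarith

theorem lt_of_adj_of_mem_goodSet [Fintype V] {G : SimpleGraph V} {M : Matrix V V ℝ} {i j : V}
    (hi : i ∈ goodSet G M) (hj : j ∈ goodSet G M) (hadj : G.Adj i j) :
    29 / 50 < M i i + M j j - M i j - M j i := by
  have key {x y : ℝ} (h : x ^ 2 + y ^ 2 < 1 / 4) : |x| + |y| < 71 / 100 := by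
    rw [← sq_abs x, ← sq_abs y] at h
    nlinarith [sq_nonneg (|x| - |y|), abs_nonneg x, abs_nonneg y]
  simp only [goodSet, Finset.mem_filter, Finset.mem_univ, true_and] at hi hj
  have hrow_i := key ((sq_add_sq_le_rowError hadj).trans_lt hi)
  have hrow_j := key ((sq_add_sq_le_rowError hadj.symm).trans_lt hj)
  linarith [neg_abs_le (M i i - 1), neg_abs_le (M j j - 1), le_abs_self (M i j),
    le_abs_self (M j i)]

theorem isIndepSet_cellClass [Fintype V] [Fintype κ] [DecidableEq (κ → ℤ)] {G : SimpleGraph V}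
    {M : Matrix V V ℝ} {a b : V → κ → ℝ} {μ : ℝ} {m : ℕ} (hM : ∀ i j, M i j = ∑ q, a i q * b j q)
    (hμ : 0 < μ) (hm : 0 < m) (hres : 3 * Fintype.card κ * μ ≤ m ^ 2) (k : V) :
    G.IsIndepSet (cellClass (goodSet G M) (cell a b μ m) k : Set V) := by
  intro i hi j hj _ hadj
  simp only [cellClass, Finset.coe_filter, Set.mem_ofPred_eq] at hi hj
  have hsum : M i i + M j j - M i j - M j i = ∑ q, (a i q - a j q) * (b i q - b j q) := by
    simp only [hM, ← Finset.sum_add_distrib, ← Finset.sum_sub_distrib]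
    exact Finset.sum_congr rfl fun q _ => by ring
  linarith [lt_of_adj_of_mem_goodSet hi.1 hj.1 hadj,
    sum_mul_sub_le_of_cell_eq hμ hm hres (hi.2.trans hj.2.symm)]

theorem card_le_mul_pow_of_card_cellClass_le [Fintype κ] [DecidableEq (κ → ℤ)] {S : Finset V}
    {cell : V → κ → ℤ} {m t : ℕ} (hm : ∀ i q, |cell i q| ≤ m)
    (ht : ∀ k, (cellClass S cell k).card ≤ t) :
    S.card ≤ t * (2 * m + 1) ^ Fintype.card κ := by
  classical
  have hbox : S.image cell ⊆ Fintype.piFinset fun _ => Finset.Icc (-(m : ℤ)) m := by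
    intro f hf
    obtain ⟨k, -, rfl⟩ := Finset.mem_image.1 hf
    exact Fintype.mem_piFinset.2 fun q => Finset.mem_Icc.2 (abs_le.1 (hm k q))
  have hfibre : ∀ f ∈ S.image cell, (S.filter fun i => cell i = f).card ≤ t := by
    intro f hf
    obtain ⟨k, -, rfl⟩ := Finset.mem_image.1 hf
    exact ht k
  calc S.card ≤ t * (S.image cell).card := Finset.card_le_mul_card_image S t hfibre
    _ ≤ t * (Fintype.piFinset fun _ : κ => Finset.Icc (-(m : ℤ)) m).card := by gcongr
    _ = t * (2 * m + 1) ^ Fintype.card κ := by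
      rw [Fintype.card_piFinset, Finset.prod_const, Finset.card_univ, Int.card_Icc]
      congr 2
      omega

end Clustering

theorem pos_of_one_le_mul_natCast {c : ℝ} {r : ℕ} (h : 1 ≤ c * r) : 0 < c ∧ 0 < r := by
  have hcr : 0 < c * r := zero_lt_one.trans_le h
  have hc := pos_of_mul_pos_left hcr r.cast_nonneg
  exact ⟨hc, by exact_mod_cast pos_of_mul_pos_right hcr hc.le⟩

theorem IsApproxCompletion.nonempty {n r : ℕ} {c ε : ℝ} {G : SimpleGraph (Fin n)}
    {M : Matrix (Fin n) (Fin n) ℝ} (h : IsApproxCompletion G M r c ε) (hr : 0 < r) :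
    Nonempty (Fin n) := by
  rw [← h.rank_eq] at hr
  exact Fin.pos_iff_nonempty.1 (hr.trans_le (by simpa using M.rank_le_card_height))

theorem IsApproxCompletion.le_card_goodSet {n r : ℕ} {c ε : ℝ} {G : SimpleGraph (Fin n)}
    {M : Matrix (Fin n) (Fin n) ℝ} (h : IsApproxCompletion G M r c ε) (hcr : 1 ≤ c * r) :
    (1 - 4 * (c * r) ^ 2 * ε) * n ≤ (goodSet G M).card := by
  have hgood := card_sub_le_card_goodSet G M
  have herr := h.error_le
  rw [revealedError_eq_sum_rowError] at herr
  rw [Fintype.card_fin] at hgood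
  have hεn : 0 ≤ ε * n := (Finset.sum_nonneg fun i _ => rowError_nonneg G M i).trans herr
  nlinarith [one_le_pow₀ (n := 2) hcr]

theorem le_indepBound_denom {r : ℕ} {c x : ℝ} (hcr : 1 ≤ c * r) (hx : x ≤ 8 * √(c * r))
    (hx0 : 0 ≤ x) : x ^ r ≤ r * √Real.pi * (8 * √(c * r)) ^ r := by
  have hr : (1 : ℝ) ≤ r := by exact_mod_cast (pos_of_one_le_mul_natCast hcr).2
  have hpi : 1 ≤ √Real.pi := Real.one_le_sqrt.2 (by linarith [Real.pi_gt_three])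
  calc x ^ r ≤ (8 * √(c * r)) ^ r := by gcongr
    _ ≤ r * √Real.pi * (8 * √(c * r)) ^ r :=
      le_mul_of_one_le_left (by positivity) (one_le_mul_of_one_le_of_one_le hr hpi)

theorem IsApproxCompletion.indepBound_le {n m t : ℕ} {κ : Type*} [Fintype κ]
    [DecidableEq (κ → ℤ)] {c ε : ℝ} {G : SimpleGraph (Fin n)} {M : Matrix (Fin n) (Fin n) ℝ}
    {cell : Fin n → κ → ℤ} (h : IsApproxCompletion G M (Fintype.card κ) c ε)
    (hcr : 1 ≤ c * Fintype.card κ) (hcell : ∀ i q, |cell i q| ≤ m)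
    (hm : (2 * m + 1 : ℝ) ≤ 8 * √(c * Fintype.card κ))
    (ht : ∀ k, (cellClass (goodSet G M) cell k).card ≤ t) :
    indepBound n (Fintype.card κ) c ε ≤ t := by
  have hcard := card_le_mul_pow_of_card_cellClass_le hcell ht
  have hdenom := le_indepBound_denom hcr hm (by positivity)
  refine div_le_of_le_mul₀ (by positivity) (by positivity) ?_
  calc (1 - 4 * (c * Fintype.card κ) ^ 2 * ε) * n ≤ (goodSet G M).card := h.le_card_goodSet hcr
    _ ≤ t * (2 * m + 1) ^ Fintype.card κ := by exact_mod_cast hcard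
    _ ≤ _ := by gcongr

/-! ## Approximate spanners of the rows of a matrix -/

section Pivot

variable {R ρ ι : Type*} [CommRing R] [DecidableEq ι]

/-- The matrix whose row `q` is the unit vector `e_q` or row `p` of `N`, as `σ q` prescribes. -/
def basisMatrix (N : Matrix ρ ι R) (σ : ι → Option ρ) : Matrix ι ι R :=
  Matrix.of fun q j => (σ q).elim (if q = j then 1 else 0) fun p => N p j

/-- The positions of a basis that hold rows of the matrix rather than unit vectors. -/
abbrev RowPosition (σ : ι → Option ρ) := {q // (σ q).isSome}

theorem basisMatrix_apply_of_some {N : Matrix ρ ι R} {σ : ι → Option ρ} {q : ι} {p : ρ}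
    (h : σ q = some p) : basisMatrix N σ q = N p := by
  ext j
  simp [basisMatrix, h]

theorem basisMatrix_none (N : Matrix ρ ι R) : basisMatrix N (fun _ => none) = 1 := by
  ext i j
  simp [basisMatrix, Matrix.one_apply]

theorem basisMatrix_update (N : Matrix ρ ι R) (σ : ι → Option ρ) (p : ρ) (q : ι) :
    basisMatrix N (Function.update σ q (some p)) = (basisMatrix N σ).updateRow q (N p) := by
  ext i j
  by_cases h : i = q
  · subst h
    simp [basisMatrix]
  · simp [basisMatrix, h]

theorem basisMatrix_map {S : Type*} [CommRing S] (f : R →+* S) (N : Matrix ρ ι R)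
    (σ : ι → Option ρ) : basisMatrix (N.map f) σ = (basisMatrix N σ).map f := by
  ext k j
  cases h : σ k <;> simp [basisMatrix, h, apply_ite f]

variable [Fintype ι]

/-- The coordinates of the rows of `N` in the basis `σ`, scaled by the determinant of the basis. -/
def tableau (N : Matrix ρ ι R) (σ : ι → Option ρ) : Matrix ρ ι R :=
  N * (basisMatrix N σ).adjugate

/-- Exchanging the vector at position `q` of the basis `σ` for row `p` of `N` increases the number
of rows of `N` in the basis, or else the absolute value of the determinant by a factor of more
than `3 / 2`. -/
def Improvable [LinearOrder R] (N : Matrix ρ ι R) (σ : ι → Option ρ) (p : ρ) (q : ι) : Prop :=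
  if (σ q).isSome then 9 * (basisMatrix N σ).det ^ 2 < 4 * tableau N σ p q ^ 2
  else tableau N σ p q ≠ 0

/-- A `3 / 2`-approximate barycentric spanner of the rows of `N`, completed to a basis by unit
vectors. -/
structure IsApproxSpanner [LinearOrder R] (N : Matrix ρ ι R) (σ : ι → Option ρ) : Prop where
  det_ne_zero : (basisMatrix N σ).det ≠ 0
  not_improvable : ∀ p q, ¬ Improvable N σ p q

theorem tableau_none (N : Matrix ρ ι R) : tableau N (fun _ => none) = N := by
  simp [tableau, basisMatrix_none]

theorem tableau_apply (N : Matrix ρ ι R) (σ : ι → Option ρ) (p : ρ) (q : ι) :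
    tableau N σ p q = (basisMatrix N (Function.update σ q (some p))).det := by
  rw [basisMatrix_update, ← Matrix.cramer_transpose_apply, Matrix.cramer_eq_adjugate_mulVec,
    ← Matrix.adjugate_transpose]
  simp [tableau, Matrix.mul_apply, Matrix.mulVec, dotProduct, mul_comm]

theorem tableau_mul_basisMatrix (N : Matrix ρ ι R) (σ : ι → Option ρ) :
    tableau N σ * basisMatrix N σ = (basisMatrix N σ).det • N := by
  rw [tableau, Matrix.mul_assoc, Matrix.adjugate_mul, Matrix.mul_smul, Matrix.mul_one]

theorem tableau_update_self (N : Matrix ρ ι R) (σ : ι → Option ρ) (p i : ρ) (q : ι) :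
    tableau N (Function.update σ q (some p)) i q = tableau N σ i q := by
  rw [tableau_apply, tableau_apply, Function.update_idem]

theorem mul_updateRow_of_col_eq_zero {W : Matrix ρ ι R} {q : ι} (hW : ∀ i, W i q = 0)
    (B : Matrix ι ι R) (v : ι → R) : W * B.updateRow q v = W * B := by
  ext i j
  rw [Matrix.mul_apply, Matrix.mul_apply]
  refine Finset.sum_congr rfl fun k _ => ?_
  by_cases hk : k = q
  · simp [hk, hW]
  · rw [Matrix.updateRow_ne hk]

theorem eq_of_mul_eq_mul_of_det_ne_zero [IsDomain R] {X Y : Matrix ρ ι R} {B : Matrix ι ι R}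
    (hB : B.det ≠ 0) (h : X * B = Y * B) : X = Y := by
  have h' := congrArg (· * B.adjugate) h
  simp only [Matrix.mul_assoc, Matrix.mul_adjugate, Matrix.mul_smul, Matrix.mul_one] at h'
  ext i j
  exact mul_left_cancel₀ hB (congrFun₂ h' i j)

theorem det_mul_tableau_update [IsDomain R] {N : Matrix ρ ι R} {σ : ι → Option ρ} {p : ρ} {q : ι}
    (hpq : tableau N σ p q ≠ 0) (i : ρ) {j : ι} (hj : j ≠ q) :
    (basisMatrix N σ).det * tableau N (Function.update σ q (some p)) i j =
      tableau N σ i j * tableau N σ p q - tableau N σ i q * tableau N σ p j := by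
  set T := tableau N σ
  set D := (basisMatrix N σ).det
  set σ' := Function.update σ q (some p) with hσ'
  let W := T p q • T - Matrix.vecMulVec (fun i => T i q) (T p)
  have hdet : (basisMatrix N σ').det = T p q := (tableau_apply N σ p q).symm
  have hcol (i : ρ) : W i q = 0 := by
    simp only [W, Matrix.sub_apply, Matrix.smul_apply, smul_eq_mul, Matrix.vecMulVec_apply]
    ring
  have hrow : Matrix.vecMul (T p) (basisMatrix N σ) = D • N p :=
    congrFun (tableau_mul_basisMatrix N σ) p
  have hW : (W + D • Matrix.vecMulVec (fun i => T i q) (Pi.single q 1)) * basisMatrix N σ' =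
      (D • tableau N σ') * basisMatrix N σ' := by
    rw [Matrix.add_mul, Matrix.smul_mul, Matrix.smul_mul, tableau_mul_basisMatrix, hdet, hσ',
      basisMatrix_update, mul_updateRow_of_col_eq_zero hcol, Matrix.sub_mul, Matrix.smul_mul,
      tableau_mul_basisMatrix, Matrix.vecMulVec_mul, Matrix.vecMulVec_mul, hrow,
      Matrix.single_one_vecMul, Matrix.row_def]
    dsimp only
    rw [Matrix.updateRow_self, Matrix.vecMulVec_smul, sub_add_cancel, smul_comm]
  have hij := congrFun₂ (eq_of_mul_eq_mul_of_det_ne_zero (hdet.trans_ne hpq) hW) i j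
  simp only [W, Matrix.add_apply, Matrix.sub_apply, Matrix.smul_apply, Matrix.vecMulVec_apply,
    smul_eq_mul, Pi.single_eq_of_ne hj, mul_zero, add_zero] at hij
  rw [← hij, mul_comm (T i j)]

theorem card_rowPosition_update (σ : ι → Option ρ) (p : ρ) (q : ι) :
    Fintype.card (RowPosition (Function.update σ q (some p))) =
      Fintype.card (RowPosition σ) + if (σ q).isSome then 0 else 1 := by
  have hinsert : ({k | (Function.update σ q (some p) k).isSome} : Finset ι) =
      insert q ({k | (σ k).isSome} : Finset ι) := by
    ext k
    by_cases h : k = q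
    · simp [h]
    · simp [h]
  rw [Fintype.card_subtype, Fintype.card_subtype, hinsert]
  split_ifs with h
  · rw [Finset.insert_eq_of_mem (by simpa using h), add_zero]
  · rw [Finset.card_insert_of_notMem (by simpa using h)]

theorem det_basisMatrix_map {S : Type*} [CommRing S] (f : R →+* S) (N : Matrix ρ ι R)
    (σ : ι → Option ρ) : (basisMatrix (N.map f) σ).det = f (basisMatrix N σ).det := by
  rw [basisMatrix_map, f.map_det]
  rfl

theorem tableau_map {S : Type*} [CommRing S] (f : R →+* S) (N : Matrix ρ ι R)
    (σ : ι → Option ρ) (p : ρ) (q : ι) : tableau (N.map f) σ p q = f (tableau N σ p q) := by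
  rw [tableau_apply, tableau_apply, det_basisMatrix_map]

theorem det_basisMatrix_smul (c : R) (N : Matrix ρ ι R) (σ : ι → Option ρ) :
    (basisMatrix (c • N) σ).det =
      c ^ Fintype.card (RowPosition σ) * (basisMatrix N σ).det := by
  have hdiag : basisMatrix (c • N) σ =
      Matrix.diagonal (fun q => if (σ q).isSome then c else 1) * basisMatrix N σ := by
    ext k j
    cases h : σ k <;> simp [basisMatrix, h]
  rw [hdiag, Matrix.det_mul, Matrix.det_diagonal, Finset.prod_ite, Finset.prod_const_one, mul_one,
    Finset.prod_const, Fintype.card_subtype]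

theorem tableau_smul (c : R) (N : Matrix ρ ι R) (σ : ι → Option ρ) (p : ρ) (q : ι) :
    tableau (c • N) σ p q = c ^ (Fintype.card (RowPosition σ) + if (σ q).isSome then 0 else 1) *
      tableau N σ p q := by
  rw [tableau_apply, det_basisMatrix_smul, ← tableau_apply, card_rowPosition_update]

end Pivot

section Spanner

variable {R ρ ι : Type*} [CommRing R] [LinearOrder R] [DecidableEq ι] [Fintype ι]
  {N : Matrix ρ ι R} {σ : ι → Option ρ} {p : ρ} {q : ι}

theorem Improvable.tableau_ne_zero [IsStrictOrderedRing R] (h : Improvable N σ p q) :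
    tableau N σ p q ≠ 0 := by
  unfold Improvable at h
  split_ifs at h with hq
  · intro h0
    rw [h0] at h
    nlinarith [sq_nonneg (basisMatrix N σ).det]
  · exact h

theorem IsApproxSpanner.tableau_eq_zero (h : IsApproxSpanner N σ) (hq : (σ q).isSome = false)
    (p : ρ) : tableau N σ p q = 0 := by
  simpa [Improvable, hq] using h.not_improvable p q

theorem exists_isApproxSpanner [IsStrictOrderedRing R] [Finite ρ] (N : Matrix ρ ι R) :
    ∃ σ, IsApproxSpanner N σ := by
  classical
  have := Fintype.ofFinite ρ
  obtain ⟨σ, hσ, hmax⟩ := Finset.exists_max_image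
    {σ : ι → Option ρ | (basisMatrix N σ).det ≠ 0}
    (fun σ => toLex (Fintype.card (RowPosition σ), |(basisMatrix N σ).det|))
    ⟨fun _ => none, by simp [basisMatrix_none]⟩
  simp only [Finset.mem_filter, Finset.mem_univ, true_and] at hσ hmax
  refine ⟨σ, hσ, fun p q himp => ?_⟩
  have hle := hmax (Function.update σ q (some p))
    ((tableau_apply N σ p q).symm.trans_ne himp.tableau_ne_zero)
  rw [card_rowPosition_update, ← tableau_apply, Prod.Lex.toLex_le_toLex] at hle
  unfold Improvable at himp
  split_ifs at hle himp
  · have habs : |tableau N σ p q| ≤ |(basisMatrix N σ).det| := by simpa using hle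
    linarith [sq_le_sq.2 habs, sq_nonneg (basisMatrix N σ).det]
  · simp at hle

theorem IsApproxSpanner.map {S : Type*} [CommRing S] [LinearOrder S]
    (h : IsApproxSpanner N σ) {f : R →+* S} (hf : StrictMono f) :
    IsApproxSpanner (N.map f) σ := by
  refine ⟨?_, fun p q himp => h.not_improvable p q ?_⟩
  · rw [det_basisMatrix_map]
    exact (map_ne_zero_iff f hf.injective).2 h.det_ne_zero
  · unfold Improvable at himp ⊢
    rw [det_basisMatrix_map, tableau_map] at himp
    split_ifs at himp ⊢
    · exact hf.lt_iff_lt.1 (by simpa [map_ofNat] using himp)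
    · exact (map_ne_zero_iff f hf.injective).1 himp

theorem IsApproxSpanner.smul [IsStrictOrderedRing R] (h : IsApproxSpanner N σ) {c : R}
    (hc : c ≠ 0) : IsApproxSpanner (c • N) σ := by
  refine ⟨?_, fun p q himp => h.not_improvable p q ?_⟩
  · rw [det_basisMatrix_smul]
    exact mul_ne_zero (pow_ne_zero _ hc) h.det_ne_zero
  · unfold Improvable at himp ⊢
    rw [det_basisMatrix_smul, tableau_smul] at himp
    split_ifs at himp ⊢
    · rw [add_zero] at himp
      have hpos := pow_pos (sq_pos_of_ne_zero hc) (Fintype.card (RowPosition σ))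
      refine lt_of_mul_lt_mul_left ?_ hpos.le
      linear_combination himp
    · exact right_ne_zero_of_mul himp

end Spanner

section Field

variable {F ρ ι : Type*} [Field F] [DecidableEq ι] [Fintype ι] {N : Matrix ρ ι F} {σ : ι → Option ρ}

/-- The coordinates of row `p` of `N` in the rows that the basis `σ` selects. -/
def spannerCoord (N : Matrix ρ ι F) (σ : ι → Option ρ) (p : ρ) (q : RowPosition σ) : F :=
  tableau N σ p q / (basisMatrix N σ).det

theorem spannerCoord_smul {c : F} (hc : c ≠ 0) :
    spannerCoord (c • N) σ = spannerCoord N σ := by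
  ext p q
  rw [spannerCoord, det_basisMatrix_smul, tableau_smul, if_pos q.2, add_zero,
    mul_div_mul_left _ _ (pow_ne_zero _ hc), spannerCoord]

theorem IsApproxSpanner.abs_spannerCoord_le [LinearOrder F] [IsStrictOrderedRing F]
    (h : IsApproxSpanner N σ) (p : ρ) (q : RowPosition σ) : |spannerCoord N σ p q| ≤ 3 / 2 := by
  have hD := abs_pos.2 h.det_ne_zero
  have hT : 4 * tableau N σ p q ^ 2 ≤ 9 * (basisMatrix N σ).det ^ 2 := by
    simpa [Improvable, q.2] using h.not_improvable p q
  rw [spannerCoord, abs_div, div_le_iff₀ hD]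
  refine abs_le_of_sq_le_sq' ?_ (by positivity) |> abs_le.2
  rw [mul_pow, sq_abs]
  linarith

theorem IsApproxSpanner.eq_sum [LinearOrder F] (h : IsApproxSpanner N σ) (i : ρ) (j : ι) :
    N i j = ∑ q, spannerCoord N σ i q * basisMatrix N σ q j := by
  have hmul : ∑ q, tableau N σ i q * basisMatrix N σ q j = (basisMatrix N σ).det * N i j :=
    congrFun₂ (tableau_mul_basisMatrix N σ) i j
  have hsub : ∑ q, tableau N σ i q * basisMatrix N σ q j =
      ∑ q : RowPosition σ, tableau N σ i q * basisMatrix N σ q j := by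
    refine (Finset.sum_subset (Finset.subset_univ {q | (σ q).isSome}) fun q _ hq => ?_).symm.trans
      (Finset.sum_subtype _ (by simp) _)
    rw [h.tableau_eq_zero (by simpa using hq), zero_mul]
  rw [← mul_right_inj' h.det_ne_zero, ← hmul, hsub, Finset.mul_sum]
  refine Finset.sum_congr rfl fun q _ => ?_
  rw [spannerCoord, ← mul_assoc, mul_div_cancel₀ _ h.det_ne_zero]

theorem IsApproxSpanner.rank_eq [LinearOrder F] [Finite ρ] (h : IsApproxSpanner N σ) :
    N.rank = Fintype.card (RowPosition σ) := by
  apply le_antisymm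
  · have hN : N = Matrix.of (spannerCoord N σ) *
        (basisMatrix N σ).submatrix (fun q : RowPosition σ => (q : ι)) id := by
      ext i j
      exact h.eq_sum i j
    rw [hN]
    exact (Matrix.rank_mul_le_left _ _).trans (Matrix.rank_le_card_width _)
  · have hli : LinearIndependent F fun q : RowPosition σ => (basisMatrix N σ).row q :=
      (Matrix.linearIndependent_rows_of_det_ne_zero h.det_ne_zero).comp _ Subtype.val_injective
    rw [Matrix.rank_eq_finrank_span_row, ← finrank_span_eq_card hli]
    refine Submodule.finrank_mono (Submodule.span_mono ?_)
    rintro _ ⟨⟨q, hq⟩, rfl⟩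
    obtain ⟨p, hp⟩ := Option.isSome_iff_exists.1 hq
    exact ⟨p, (basisMatrix_apply_of_some hp).symm⟩

end Field

/-! ## Cells of an approximate spanner -/

section SpannerCell

variable {V : Type*} [Fintype V] [DecidableEq V] {M : Matrix V V ℝ} {σ : V → Option V} {μ : ℝ}
  {m : ℕ}

/-- The cells of the vertices for the factorization of `M` through the rows that `σ` selects. -/
noncomputable def spannerCell (M : Matrix V V ℝ) (σ : V → Option V) (μ : ℝ) (m : ℕ) :
    V → RowPosition σ → ℤ :=
  cell (spannerCoord M σ) (fun j q => basisMatrix M σ q j) μ m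

theorem IsApproxSpanner.abs_spannerCell_le (h : IsApproxSpanner M σ) (hμ : ∀ i j, |M i j| ≤ μ)
    (i : V) (q : RowPosition σ) : |spannerCell M σ μ m i q| ≤ m := by
  obtain ⟨p, hp⟩ := Option.isSome_iff_exists.1 q.2
  refine abs_cell_le (h.abs_spannerCoord_le i q) ?_
  rw [basisMatrix_apply_of_some hp]
  exact hμ p i

theorem IsApproxSpanner.isIndepSet_cellClass (h : IsApproxSpanner M σ) (G : SimpleGraph V)
    (hμ : 0 < μ) (hm : 0 < m) (hres : 3 * M.rank * μ ≤ m ^ 2) (k : V) :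
    G.IsIndepSet (cellClass (goodSet G M) (spannerCell M σ μ m) k : Set V) := by
  rw [h.rank_eq] at hres
  exact _root_.isIndepSet_cellClass h.eq_sum hμ hm hres k

end SpannerCell

theorem IsApproxSpanner.indepBound_le {n r m t : ℕ} {c ε μ : ℝ} {G : SimpleGraph (Fin n)}
    {M : Matrix (Fin n) (Fin n) ℝ} {σ : Fin n → Option (Fin n)} (hσ : IsApproxSpanner M σ)
    (h : IsApproxCompletion G M r c ε) (hcr : 1 ≤ c * r) (hμ : ∀ i j, |M i j| ≤ μ)
    (hm : (2 * m + 1 : ℝ) ≤ 8 * √(c * r))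
    (ht : ∀ k, (cellClass (goodSet G M) (spannerCell M σ μ m) k).card ≤ t) :
    indepBound n r c ε ≤ t := by
  obtain rfl : Fintype.card (RowPosition σ) = r := hσ.rank_eq.symm.trans h.rank_eq
  exact IsApproxCompletion.indepBound_le h hcr (hσ.abs_spannerCell_le hμ) hm ht

theorem exists_resolution {x : ℝ} (hx : 1 ≤ x) :
    ∃ m : ℕ, 0 < m ∧ 3 * x ≤ m ^ 2 ∧ (2 * m + 1 : ℝ) ≤ 8 * √x := by
  have hceil : √3 * √x ≤ ⌈√3 * √x⌉₊ := Nat.le_ceil _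
  have hpos : 0 < √3 * √x := by positivity
  have hx1 : 1 ≤ √x := Real.one_le_sqrt.2 hx
  have h3 : √3 ≤ 2 := (Real.sqrt_le_left (by norm_num)).2 (by norm_num)
  refine ⟨⌈√3 * √x⌉₊, Nat.ceil_pos.2 hpos, ?_, ?_⟩
  · calc 3 * x = (√3 * √x) ^ 2 := by rw [mul_pow, Real.sq_sqrt, Real.sq_sqrt] <;> linarith
      _ ≤ _ := by gcongr
  · nlinarith [Nat.ceil_lt_add_one hpos.le]

theorem exists_isIndepSet_indepBound_le {n r : ℕ} {c ε : ℝ} {G : SimpleGraph (Fin n)}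
    {M : Matrix (Fin n) (Fin n) ℝ} (hcr : 1 ≤ c * r) (h : IsApproxCompletion G M r c ε) :
    ∃ T : Finset (Fin n), G.IsIndepSet (T : Set (Fin n)) ∧ indepBound n r c ε ≤ T.card := by
  obtain ⟨σ, hσ⟩ := exists_isApproxSpanner M
  obtain ⟨m, hm, hres, hm8⟩ := exists_resolution hcr
  obtain ⟨hc, hr⟩ := pos_of_one_le_mul_natCast hcr
  have hn := h.nonempty hr
  obtain ⟨k, -, hk⟩ := Finset.exists_max_image Finset.univ
    (fun k => (cellClass (goodSet G M) (spannerCell M σ c m) k).card) Finset.univ_nonempty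
  refine ⟨_, hσ.isIndepSet_cellClass G hc hm ?_ k,
    hσ.indepBound_le h hcr h.abs_le hm8 fun j => hk j (Finset.mem_univ j)⟩
  rw [h.rank_eq]
  linarith

/-! ## Programs with bounded values and cost -/

namespace LogRAM

theorem one_le_bits (z : ℤ) : 1 ≤ bits z := Nat.le_add_left _ _

theorem bits_le_of_natAbs_lt {z : ℤ} {k : ℕ} (h : z.natAbs < 2 ^ k) : bits z ≤ k + 1 :=
  Nat.succ_le_succ (Nat.size_le.2 h)

theorem bits_le_of_abs_le {z : ℤ} {H : ℕ} (h : |z| ≤ H) : bits z ≤ H.size + 1 :=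
  Nat.succ_le_succ (Nat.size_le_size (by rw [Int.abs_eq_natAbs] at h; exact_mod_cast h))

theorem natAbs_lt_two_pow_bits (z : ℤ) : z.natAbs < 2 ^ (bits z - 1) :=
  Nat.lt_size_self z.natAbs

theorem bits_add_le (x y : ℤ) : bits (x + y) ≤ bits x + bits y := by
  obtain ⟨a, ha⟩ := Nat.exists_eq_add_of_le' (one_le_bits x)
  obtain ⟨b, hb⟩ := Nat.exists_eq_add_of_le' (one_le_bits y)
  have hx := natAbs_lt_two_pow_bits x
  have hy := natAbs_lt_two_pow_bits y
  rw [ha, Nat.add_sub_cancel] at hx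
  rw [hb, Nat.add_sub_cancel] at hy
  have hpow : 2 ^ a + 2 ^ b ≤ 2 ^ (a + b + 1) := by
    have := Nat.pow_le_pow_right two_pos (Nat.le_add_right a b)
    have := Nat.pow_le_pow_right two_pos (Nat.le_add_left b a)
    rw [pow_succ]
    omega
  have := bits_le_of_natAbs_lt (z := x + y) (k := a + b + 1) (by omega)
  omega

theorem bits_sub_le (x y : ℤ) : bits (x - y) ≤ bits x + bits y := by
  simpa [sub_eq_add_neg, bits] using bits_add_le x (-y)

theorem bits_mul_le (x y : ℤ) : bits (x * y) ≤ bits x + bits y := by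
  have hmul : (x * y).natAbs < 2 ^ (bits x - 1 + (bits y - 1)) := by
    rw [Int.natAbs_mul, pow_add]
    exact Nat.mul_lt_mul'' (natAbs_lt_two_pow_bits x) (natAbs_lt_two_pow_bits y)
  have := bits_le_of_natAbs_lt hmul
  have := one_le_bits x
  have := one_le_bits y
  omega

theorem bits_div_le (x y : ℤ) : bits (x / y) ≤ bits x :=
  Nat.succ_le_succ (Nat.size_le_size (Int.natAbs_ediv_le_natAbs x y))

/-- The number of nodes of an expression, constants counted with their bit length. -/
def Expr.weight : Expr → ℕ
  | .const z => bits z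
  | .var _ => 1
  | .get _ i => i.weight + 1
  | .add e f => e.weight + f.weight + 1
  | .sub e f => e.weight + f.weight + 1
  | .mul e f => e.weight + f.weight + 1
  | .div e f => e.weight + f.weight + 1

/-- All the values in the memory are at most `H` in absolute value. -/
structure State.Within (s : State) (H : ℕ) : Prop where
  abs_var_le : ∀ x, |s.var x| ≤ H
  abs_arr_le : ∀ a z, |s.arr a z| ≤ H

theorem Expr.bits_eval_le {s : State} {H : ℕ} (hs : s.Within H) (e : Expr) :
    bits (e.eval s) ≤ e.weight * (H.size + 1) := by
  induction e with
  | const z => exact Nat.le_mul_of_pos_right _ (Nat.succ_pos _)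
  | var x => simpa [Expr.weight, Expr.eval] using bits_le_of_abs_le (hs.abs_var_le x)
  | get a i _ =>
    have := bits_le_of_abs_le (hs.abs_arr_le a (i.eval s))
    simp only [Expr.eval, Expr.weight]
    nlinarith
  | add e f he hf =>
    have := bits_add_le (e.eval s) (f.eval s)
    simp only [Expr.eval, Expr.weight]
    nlinarith
  | sub e f he hf =>
    have := bits_sub_le (e.eval s) (f.eval s)
    simp only [Expr.eval, Expr.weight]
    nlinarith
  | mul e f he hf =>
    have := bits_mul_le (e.eval s) (f.eval s)
    simp only [Expr.eval, Expr.weight]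
    nlinarith
  | div e f he hf =>
    have := bits_div_le (e.eval s) (f.eval s)
    simp only [Expr.eval, Expr.weight]
    nlinarith

theorem Expr.cost_le {s : State} {H : ℕ} (hs : s.Within H) (e : Expr) :
    e.cost s ≤ e.weight ^ 2 * (H.size + 1) := by
  have binary {e f g : Expr} (hg : g.weight = e.weight + f.weight + 1)
      (he : e.cost s ≤ e.weight ^ 2 * (H.size + 1)) (hf : f.cost s ≤ f.weight ^ 2 * (H.size + 1)) :
      e.cost s + f.cost s + bits (g.eval s) ≤ g.weight ^ 2 * (H.size + 1) := by
    have hbits := g.bits_eval_le hs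
    rw [hg] at hbits ⊢
    calc e.cost s + f.cost s + bits (g.eval s)
        ≤ (e.weight ^ 2 + f.weight ^ 2 + (e.weight + f.weight + 1)) * (H.size + 1) := by linarith
      _ ≤ (e.weight + f.weight + 1) ^ 2 * (H.size + 1) := by
        gcongr
        nlinarith
  induction e with
  | const z =>
    have := one_le_bits z
    simp only [Expr.cost, Expr.weight]
    nlinarith [Nat.zero_le (bits z ^ 2 * H.size)]
  | var x => simpa [Expr.cost, Expr.weight] using bits_le_of_abs_le (hs.abs_var_le x)
  | get a i hi =>
    have := bits_le_of_abs_le (hs.abs_arr_le a (i.eval s))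
    simp only [Expr.cost, Expr.weight]
    nlinarith [Nat.zero_le (i.weight * (H.size + 1))]
  | add e f he hf => exact binary (g := .add e f) rfl he hf
  | sub e f he hf => exact binary (g := .sub e f) rfl he hf
  | mul e f he hf => exact binary (g := .mul e f) rfl he hf
  | div e f he hf => exact binary (g := .div e f) rfl he hf

/-- The variables that a program may change. -/
def Prog.wvars : Prog → List ℕ
  | .skip => []
  | .assign x _ => [x]
  | .put _ _ _ => []
  | .seq p q => p.wvars ++ q.wvars
  | .ite _ p q => p.wvars ++ q.wvars
  | .while _ p => p.wvars

/-- The arrays that a program may change. -/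
def Prog.warrs : Prog → List ℕ
  | .skip => []
  | .assign _ _ => []
  | .put a _ _ => [a]
  | .seq p q => p.warrs ++ q.warrs
  | .ite _ p q => p.warrs ++ q.warrs
  | .while _ p => p.warrs

/-- The memory `s'` agrees with `s` on everything that the program `p` cannot change. -/
structure Frame (p : Prog) (s s' : State) : Prop where
  var_eq : ∀ x ∉ p.wvars, s'.var x = s.var x
  arr_eq : ∀ a ∉ p.warrs, s'.arr a = s.arr a

namespace Frame

variable {p q : Prog} {s s₁ s₂ : State}

theorem refl (p : Prog) (s : State) : Frame p s s := ⟨fun _ _ => rfl, fun _ _ => rfl⟩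

theorem trans (h₁ : Frame p s s₁) (h₂ : Frame p s₁ s₂) : Frame p s s₂ :=
  ⟨fun x hx => (h₂.var_eq x hx).trans (h₁.var_eq x hx),
    fun a ha => (h₂.arr_eq a ha).trans (h₁.arr_eq a ha)⟩

theorem mono (h : Frame p s s₁) (hv : p.wvars ⊆ q.wvars) (ha : p.warrs ⊆ q.warrs) :
    Frame q s s₁ :=
  ⟨fun x hx => h.var_eq x fun h => hx (hv h), fun a ha' => h.arr_eq a fun h => ha' (ha h)⟩

theorem seq_left (h : Frame p s s₁) : Frame (.seq p q) s s₁ :=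
  h.mono (List.subset_append_left _ _) (List.subset_append_left _ _)

theorem seq_right (h : Frame q s s₁) : Frame (.seq p q) s s₁ :=
  h.mono (List.subset_append_right _ _) (List.subset_append_right _ _)

theorem while_body {e : Expr} (h : Frame p s s₁) : Frame (.while e p) s s₁ := ⟨h.var_eq, h.arr_eq⟩

end Frame

theorem Exec.frame {p : Prog} {s s' : State} {t : ℕ} (h : Exec p s s' t) : Frame p s s' := by
  induction h with
  | skip => exact .refl _ _
  | assign y e s => exact ⟨fun x hx => Function.update_of_ne (by simpa [Prog.wvars] using hx) _ _,
      fun _ _ => rfl⟩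
  | put b i e s => exact ⟨fun _ _ => rfl,
      fun a ha => Function.update_of_ne (by simpa [Prog.warrs] using ha) _ _⟩
  | seq _ _ h₁ h₂ => exact h₁.seq_left.trans h₂.seq_right
  | ite_true _ _ h => exact ⟨h.seq_left.var_eq, h.seq_left.arr_eq⟩
  | ite_false _ _ h => exact ⟨h.seq_right.var_eq, h.seq_right.arr_eq⟩
  | while_true _ _ _ h₁ h₂ => exact .trans ⟨h₁.var_eq, h₁.arr_eq⟩ h₂
  | while_false => exact .refl _ _

/-- The length of a program, its expressions counted with their squared weights. -/
def Prog.weight : Prog → ℕ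
  | .skip => 1
  | .assign _ e => e.weight ^ 2 + 1
  | .put _ i e => i.weight ^ 2 + e.weight ^ 2 + 1
  | .seq p q => p.weight + q.weight
  | .ite e p q => e.weight ^ 2 + p.weight + q.weight + 1
  | .while e p => e.weight ^ 2 + p.weight + 1

/-- The nesting depth of the loops of a program. -/
def Prog.depth : Prog → ℕ
  | .skip => 0
  | .assign _ _ => 0
  | .put _ _ _ => 0
  | .seq p q => max p.depth q.depth
  | .ite _ p q => max p.depth q.depth
  | .while _ p => p.depth + 1

/-- A bound for the cost of a program on values bounded by `H`, if none of its loops is ever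
iterated more than `B` times. -/
def Prog.costBound (H B : ℕ) (p : Prog) : ℕ := p.weight * (B + 1) ^ p.depth * (H.size + 1)

/-- Started in a memory `s` with values bounded by `H`, the program `p` halts with `Q` satisfied,
its values still bounded by `H`, within the cost that `B` iterations of each loop allow for. -/
def Achieves (H B : ℕ) (p : Prog) (s : State) (Q : State → Prop) : Prop :=
  s.Within H → ∃ (s' : State) (t : ℕ), Exec p s s' t ∧ t ≤ p.costBound H B ∧ s'.Within H ∧ Q s'

theorem State.Within.setVar {s : State} {H : ℕ} (hs : s.Within H) (x : ℕ) {z : ℤ} (hz : |z| ≤ H) :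
    (s.setVar x z).Within H := by
  refine ⟨fun y => ?_, hs.abs_arr_le⟩
  by_cases h : y = x
  · simpa [State.setVar, h] using hz
  · simpa [State.setVar, h] using hs.abs_var_le y

theorem State.Within.setArr {s : State} {H : ℕ} (hs : s.Within H) (a : ℕ) (i : ℤ) {z : ℤ}
    (hz : |z| ≤ H) : (s.setArr a i z).Within H := by
  refine ⟨hs.abs_var_le, fun b j => ?_⟩
  by_cases hb : b = a
  · by_cases hj : j = i
    · simpa [State.setArr, hb, hj] using hz
    · simpa [State.setArr, hb, hj] using hs.abs_arr_le a j
  · simpa [State.setArr, hb] using hs.abs_arr_le b j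

namespace Achieves

variable {H B : ℕ} {p q : Prog} {e : Expr} {s : State} {Q R : State → Prop}

theorem mono (h : Achieves H B p s Q) (hQ : ∀ s', Frame p s s' → Q s' → R s') :
    Achieves H B p s R := fun hs =>
  let ⟨s', t, hexec, ht, hs', hq⟩ := h hs
  ⟨s', t, hexec, ht, hs', hQ s' hexec.frame hq⟩

theorem of_within (h : s.Within H → Achieves H B p s Q) : Achieves H B p s Q :=
  fun hs => h hs hs

theorem skip (h : Q s) : Achieves H B .skip s Q := fun hs =>
  ⟨s, 1, .skip s, by simp [Prog.costBound, Prog.weight, Prog.depth], hs, h⟩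

theorem assign {x : ℕ} {z : ℤ} (he : e.eval s = z) (hz : |z| ≤ H) (h : Q (s.setVar x z)) :
    Achieves H B (.assign x e) s Q := fun hs => by
  subst he
  refine ⟨_, _, .assign x e s, ?_, hs.setVar x hz, h⟩
  have := e.cost_le hs
  simp only [Prog.costBound, Prog.weight, Prog.depth]
  linarith

theorem put {a : ℕ} {i : Expr} {y z : ℤ} (hi : i.eval s = y) (he : e.eval s = z) (hz : |z| ≤ H)
    (h : Q (s.setArr a y z)) : Achieves H B (.put a i e) s Q := fun hs => by
  subst hi he
  refine ⟨_, _, .put a i e s, ?_, hs.setArr a _ hz, h⟩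
  have := e.cost_le hs
  have := i.cost_le hs
  simp only [Prog.costBound, Prog.weight, Prog.depth]
  linarith

theorem seq (hp : Achieves H B p s Q)
    (hq : ∀ s₁, Frame p s s₁ → Q s₁ → Achieves H B q s₁ R) : Achieves H B (.seq p q) s R := by
  intro hs
  obtain ⟨s₁, t₁, hexec₁, ht₁, hs₁, hQ⟩ := hp hs
  obtain ⟨s₂, t₂, hexec₂, ht₂, hs₂, hR⟩ := hq s₁ hexec₁.frame hQ hs₁
  refine ⟨s₂, _, .seq hexec₁ hexec₂, ?_, hs₂, hR⟩
  calc t₁ + t₂ ≤ p.weight * (B + 1) ^ max p.depth q.depth * (H.size + 1) +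
        q.weight * (B + 1) ^ max p.depth q.depth * (H.size + 1) := by
        refine add_le_add (ht₁.trans ?_) (ht₂.trans ?_)
        · unfold Prog.costBound
          gcongr
          · omega
          · exact le_max_left _ _
        · unfold Prog.costBound
          gcongr
          · omega
          · exact le_max_right _ _
    _ = (Prog.seq p q).costBound H B := by
      simp only [Prog.costBound, Prog.weight, Prog.depth]
      ring

theorem ite (hp : 0 < e.eval s → Achieves H B p s Q) (hq : e.eval s ≤ 0 → Achieves H B q s Q) :
    Achieves H B (.ite e p q) s Q := by
  intro hs
  have hcost (r : Prog) (hw : r.weight ≤ p.weight + q.weight)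
      (hd : r.depth ≤ max p.depth q.depth) {t : ℕ} (ht : t ≤ r.costBound H B) :
      e.cost s + t + 1 ≤ (Prog.ite e p q).costBound H B := by
    calc e.cost s + t + 1 ≤ (e.weight ^ 2 + 1) * 1 * (H.size + 1) + r.costBound H B := by
          linarith [e.cost_le hs]
      _ ≤ (e.weight ^ 2 + 1) * (B + 1) ^ max p.depth q.depth * (H.size + 1) +
          (p.weight + q.weight) * (B + 1) ^ max p.depth q.depth * (H.size + 1) := by
        unfold Prog.costBound
        gcongr
        · exact Nat.one_le_pow _ _ (Nat.succ_pos _)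
        · omega
      _ = (Prog.ite e p q).costBound H B := by
        simp only [Prog.costBound, Prog.weight, Prog.depth]
        ring
  rcases lt_or_ge 0 (e.eval s) with h | h
  · obtain ⟨s', t, hexec, ht, hs', hQ⟩ := hp h hs
    exact ⟨s', _, .ite_true h hexec, hcost p (by omega) (le_max_left _ _) ht, hs', hQ⟩
  · obtain ⟨s', t, hexec, ht, hs', hQ⟩ := hq h hs
    exact ⟨s', _, .ite_false h hexec, hcost q (by omega) (le_max_right _ _) ht, hs', hQ⟩

theorem while_of_measure (Inv : ℕ → State → Prop) {μ : ℕ} (hμ : μ ≤ B) (h₀ : Inv μ s)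
    (hstep : ∀ μ s₁, s₁.Within H → Frame (.while e p) s s₁ → Inv μ s₁ → 0 < e.eval s₁ →
      Achieves H B p s₁ fun s₂ => ∃ μ' < μ, Inv μ' s₂) :
    Achieves H B (.while e p) s fun s' => (∃ μ, Inv μ s') ∧ e.eval s' ≤ 0 := by
  suffices h : ∀ μ s₁, s₁.Within H → Frame (.while e p) s s₁ → Inv μ s₁ → ∃ (s' : State) (t : ℕ),
      Exec (.while e p) s₁ s' t ∧ t ≤ (μ + 1) * ((e.weight ^ 2 + 1) * (H.size + 1) +
        p.costBound H B) ∧ s'.Within H ∧ (∃ μ, Inv μ s') ∧ e.eval s' ≤ 0 by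
    intro hs
    obtain ⟨s', t, hexec, ht, hs', hQ⟩ := h μ s hs (.refl _ _) h₀
    refine ⟨s', t, hexec, ht.trans ?_, hs', hQ⟩
    calc (μ + 1) * ((e.weight ^ 2 + 1) * (H.size + 1) + p.costBound H B)
        ≤ (B + 1) * ((e.weight ^ 2 + 1) * (B + 1) ^ p.depth * (H.size + 1) +
            p.costBound H B) := by
          gcongr
          exact Nat.le_mul_of_pos_right _ (by positivity)
      _ = (Prog.while e p).costBound H B := by
        simp only [Prog.costBound, Prog.weight, Prog.depth]
        ring
  intro μ
  induction μ using Nat.strong_induction_on with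
  | _ μ ih =>
    intro s₁ hs₁ hframe hinv
    have hcost := e.cost_le hs₁
    rcases lt_or_ge 0 (e.eval s₁) with h | h
    · obtain ⟨s₂, t₂, hexec₂, ht₂, hs₂, μ', hμ', hinv'⟩ := hstep μ s₁ hs₁ hframe hinv h hs₁
      obtain ⟨s₃, t₃, hexec₃, ht₃, hs₃, hQ⟩ :=
        ih μ' hμ' s₂ hs₂ (hframe.trans hexec₂.frame.while_body) hinv'
      refine ⟨s₃, _, .while_true h hexec₂ hexec₃, ?_, hs₃, hQ⟩
      have := Nat.mul_le_mul_right ((e.weight ^ 2 + 1) * (H.size + 1) + p.costBound H B)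
        (Nat.succ_le_of_lt hμ')
      linarith [add_one_mul μ ((e.weight ^ 2 + 1) * (H.size + 1) + p.costBound H B)]
    · refine ⟨s₁, _, .while_false h, ?_, hs₁, ⟨μ, hinv⟩, h⟩
      have := Nat.zero_le (μ * ((e.weight ^ 2 + 1) * (H.size + 1) + p.costBound H B))
      have := Nat.zero_le (p.costBound H B)
      linarith [add_one_mul μ ((e.weight ^ 2 + 1) * (H.size + 1) + p.costBound H B)]

end Achieves

end LogRAM

/-! ## Loops over vertices -/

namespace LogRAM

instance : Add Expr := ⟨.add⟩
instance : Sub Expr := ⟨.sub⟩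
instance : Mul Expr := ⟨.mul⟩
instance : Div Expr := ⟨.div⟩
instance (n : ℕ) : OfNat Expr n := ⟨.const n⟩

namespace Expr

variable (s : State) (e f : Expr)

@[simp] theorem eval_ofNat (n : ℕ) : (no_index (OfNat.ofNat n) : Expr).eval s = n := rfl
@[simp] theorem eval_var (x : ℕ) : (var x).eval s = s.var x := rfl
@[simp] theorem eval_get (a : ℕ) : (get a e).eval s = s.arr a (e.eval s) := rfl
@[simp] theorem eval_add : (e + f).eval s = e.eval s + f.eval s := rfl
@[simp] theorem eval_sub : (e - f).eval s = e.eval s - f.eval s := rfl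
@[simp] theorem eval_mul : (e * f).eval s = e.eval s * f.eval s := rfl
@[simp] theorem eval_div : (e / f).eval s = e.eval s / f.eval s := rfl

end Expr

namespace State

variable (s : State) (x y : ℕ) (a b : ℕ) (i z : ℤ)

@[simp] theorem var_setVar_self : (s.setVar x z).var x = z := Function.update_self ..

@[simp] theorem var_setVar_of_ne {x y : ℕ} (h : y ≠ x) : (s.setVar x z).var y = s.var y :=
  Function.update_of_ne h ..

@[simp] theorem arr_setVar : (s.setVar x z).arr = s.arr := rfl

@[simp] theorem var_setArr : (s.setArr a i z).var = s.var := rfl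

@[simp] theorem arr_setArr_self : (s.setArr a i z).arr a = Function.update (s.arr a) i z :=
  Function.update_self ..

@[simp] theorem arr_setArr_of_ne {a b : ℕ} (h : b ≠ a) : (s.setArr a i z).arr b = s.arr b :=
  Function.update_of_ne h ..

end State

infix:61 " ::= " => Prog.assign
infixr:60 " ;; " => Prog.seq

open LogRAM.Expr (var get)

-- `GraphMatrixInput.load` stores the dimension in variable `0`.
abbrev dimVar : ℕ := 0
abbrev rowVar : ℕ := 1
abbrev colVar : ℕ := 2
abbrev sumVar : ℕ := 3

/-- The entry of the square matrix that the array `a` stores row by row, in the row and the column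
that the variables `x` and `y` hold. -/
def entry (a x y : ℕ) : Expr := get a (var x * var dimVar + var y)

/-- The array `g` begins with the vector `f`. -/
def HoldsVector {n : ℕ} (g : ℤ → ℤ) (f : Fin n → ℤ) : Prop := ∀ i : Fin n, g i = f i

/-- The array `g` begins with the matrix `A`, stored row by row. -/
def HoldsMatrix {n : ℕ} (g : ℤ → ℤ) (A : Matrix (Fin n) (Fin n) ℤ) : Prop :=
  ∀ i j : Fin n, g (i * n + j) = A i j

/-- Run `p` with the variable `i` ranging over the indices below the dimension. -/
def forTo (i : ℕ) (p : Prog) : Prog :=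
  i ::= 0 ;; .while (var dimVar - var i) (p ;; i ::= var i + 1)

/-- Run `p` for all rows and columns of a square matrix. -/
def forMatrix (p : Prog) : Prog := forTo rowVar (forTo colVar p)

/-- Compute the sum of `e₀` and of the values of `e` with `sumVar` ranging over the indices below
the dimension in the variable `x`. -/
def sumTo (x : ℕ) (e₀ e : Expr) : Prog := x ::= e₀ ;; forTo sumVar (x ::= var x + e)

/-- Fill the vector `a` with the values of `e` after running `p`. -/
def fillVector (a : ℕ) (p : Prog) (e : Expr) : Prog := forTo rowVar (p ;; .put a (var rowVar) e)

/-- Fill the matrix `a` with the values of `e` after running `p`. -/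
def fillMatrix (a : ℕ) (p : Prog) (e : Expr) : Prog :=
  forMatrix (p ;; .put a (var rowVar * var dimVar + var colVar) e)

section Transport

variable {n : ℕ} {p : Prog} {s s' : State} {a : ℕ}

theorem Frame.var {x : ℕ} {z : ℤ} (h : Frame p s s') (hs : s.var x = z)
    (hx : x ∉ p.wvars := by decide) : s'.var x = z := (h.var_eq x hx).trans hs

theorem HoldsVector.of_frame {f : Fin n → ℤ} (hf : HoldsVector (s.arr a) f) (h : Frame p s s')
    (ha : a ∉ p.warrs := by decide) : HoldsVector (s'.arr a) f := by rwa [h.arr_eq a ha]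

theorem HoldsMatrix.of_frame {A : Matrix (Fin n) (Fin n) ℤ} (hA : HoldsMatrix (s.arr a) A)
    (h : Frame p s s') (ha : a ∉ p.warrs := by decide) : HoldsMatrix (s'.arr a) A := by
  rwa [h.arr_eq a ha]

theorem HoldsVector.eval_get {f : Fin n → ℤ} (hf : HoldsVector (s.arr a) f) {x : ℕ} {i : Fin n}
    (hx : s.var x = i) : (get a (var x)).eval s = f i := by
  rw [Expr.eval_get, Expr.eval_var, hx, hf]

theorem HoldsMatrix.eval_entry {A : Matrix (Fin n) (Fin n) ℤ} (hA : HoldsMatrix (s.arr a) A)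
    (hn : s.var dimVar = n) {x y : ℕ} {i j : Fin n} (hx : s.var x = i) (hy : s.var y = j) :
    (entry a x y).eval s = A i j := by
  simp only [entry, Expr.eval_get, Expr.eval_add, Expr.eval_mul, Expr.eval_var, hn, hx, hy, hA i j]

end Transport

theorem row_mul_add_injective {n : ℕ} {i j i' j' : Fin n}
    (h : (i : ℤ) * n + j = i' * n + j') : i = i' ∧ j = j' := by
  have h' : finProdFinEquiv (i, j) = finProdFinEquiv (i', j') := by
    ext
    simp only [finProdFinEquiv_apply_val]
    zify
    linarith
  exact Prod.mk.inj (finProdFinEquiv.injective h')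

namespace Achieves

variable {n H B : ℕ} {p : Prog} {s : State}

theorem forTo {i : ℕ} {Inv : Finset (Fin n) → State → Prop} (hn : s.var dimVar = n) (hB : n ≤ B)
    (hi : i ≠ dimVar) (hip : i ∉ p.wvars) (hdp : dimVar ∉ p.wvars)
    (hset : ∀ A s z, Inv A s → Inv A (s.setVar i z)) (h₀ : Inv ∅ s)
    (hstep : ∀ (j : Fin n) A s₁, s₁.Within H → Frame (forTo i p) s s₁ → s₁.var i = j → j ∉ A →
      Inv A s₁ → Achieves H B p s₁ (Inv (insert j A))) :
    Achieves H B (forTo i p) s (Inv Finset.univ) := by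
  refine of_within fun hs => ?_
  have hnH : (n : ℤ) ≤ H := by simpa [hn] using hs.abs_var_le dimVar
  have hdim {s₁ : State} (h : Frame (LogRAM.forTo i p) s s₁) : s₁.var dimVar = n :=
    (h.var_eq _ (by simp [LogRAM.forTo, Prog.wvars, hi.symm, hdp])).trans hn
  have hstart : Frame (LogRAM.forTo i p) s (s.setVar i 0) := (Exec.assign i 0 s).frame.seq_left
  refine (assign (Q := fun s₁ => s₁ = s.setVar i 0) rfl (by simp) rfl).seq ?_
  rintro _ - rfl
  refine (while_of_measure (fun μ s₁ => ∃ j ≤ n, μ = n - j ∧ s₁.var i = j ∧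
    Inv {k | k.val < j} s₁) (Nat.sub_le n 0 |>.trans hB)
    ⟨0, n.zero_le, rfl, by simp, by simpa using hset _ s 0 h₀⟩ ?_).mono ?_
  · rintro _ s₁ hs₁ hframe ⟨j, -, rfl, hij, hinv⟩ hpos
    have hframe : Frame (LogRAM.forTo i p) s s₁ := hstart.trans hframe.seq_right
    have hj : j < n := by simpa [hdim hframe, hij] using hpos
    refine (hstep ⟨j, hj⟩ _ s₁ hs₁ hframe hij (by simp) hinv).seq fun s₂ hframe₂ hinv₂ => ?_
    have hi₂ : s₂.var i = j := (hframe₂.var_eq i hip).trans hij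
    refine assign (z := j + 1) (by simp [hi₂]) (by rw [abs_of_nonneg (by positivity)]; omega)
      ⟨n - (j + 1), by omega, j + 1, hj, rfl, by simp, hset _ _ _ ?_⟩
    convert hinv₂ using 1
    ext k
    simp [Fin.ext_iff, Nat.le_iff_lt_or_eq, or_comm]
  · rintro s' hframe ⟨⟨_, j, hj, -, hij, hinv⟩, hle⟩
    have hj : j = n := by
      have := hframe.var_eq dimVar (by simp [Prog.wvars, hi.symm, hdp])
      simp [hij, this, hi.symm, hn] at hle
      omega
    convert hinv using 1
    ext k
    simp [hj]

theorem forMatrix {Inv : Finset (Fin n × Fin n) → State → Prop} (hn : s.var dimVar = n)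
    (hB : n ≤ B) (hp : ∀ x ∈ [dimVar, rowVar, colVar], x ∉ p.wvars)
    (hset : ∀ A s z, ∀ x ∈ [rowVar, colVar], Inv A s → Inv A (s.setVar x z)) (h₀ : Inv ∅ s)
    (hstep : ∀ (i j : Fin n) A s₁, s₁.Within H → Frame (forMatrix p) s s₁ → s₁.var rowVar = i →
      s₁.var colVar = j → (i, j) ∉ A → Inv A s₁ → Achieves H B p s₁ (Inv (insert (i, j) A))) :
    Achieves H B (forMatrix p) s (Inv Finset.univ) := by
  simp only [List.forall_mem_cons, List.not_mem_nil, false_imp_iff, implies_true, and_true] at hp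
  obtain ⟨hdim, hrow, hcol⟩ := hp
  have hframe {s₁ s₂ : State} (h : Frame (LogRAM.forTo colVar p) s₁ s₂) :
      Frame (LogRAM.forMatrix p) s₁ s₂ :=
    (Frame.while_body (e := var dimVar - var rowVar)
      (h.seq_left (q := rowVar ::= var rowVar + 1))).seq_right (p := rowVar ::= 0)
  rw [← Finset.univ_product_univ]
  refine forTo (Inv := fun A => Inv (A ×ˢ Finset.univ)) hn hB (by decide)
    (by simp [LogRAM.forTo, Prog.wvars, hrow]) (by simp [LogRAM.forTo, Prog.wvars, hdim])
    (fun A s z => hset _ s z _ (by simp)) (by simpa using h₀)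
    fun i A s₁ _ hframe₁ hi hiA hinv => ?_
  have hinsert : insert i A ×ˢ (Finset.univ : Finset (Fin n)) =
      A ×ˢ Finset.univ ∪ Finset.univ.image (i, ·) := by
    ext ⟨k, l⟩
    simp [or_comm, eq_comm]
  rw [hinsert]
  refine (forTo (Inv := fun A' => Inv (A ×ˢ Finset.univ ∪ A'.image (i, ·)))
    ((hframe₁.var_eq _ (by simp [LogRAM.forTo, Prog.wvars, hdim])).trans hn) hB (by decide)
    hcol hdim (fun A s z => hset _ s z _ (by simp)) (by simpa using hinv)
    fun j A' s₂ hs₂ hframe₂ hj hjA hinv₂ => ?_)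
  rw [Finset.image_insert, Finset.union_insert]
  exact hstep i j _ s₂ hs₂ (hframe₁.trans (hframe hframe₂))
    ((hframe₂.var_eq _ (by simp [LogRAM.forTo, Prog.wvars, hrow])).trans hi) hj
    (by simp [hiA, hjA]) hinv₂

theorem sumTo {x : ℕ} {e₀ e : Expr} {z : ℤ} {F : Fin n → ℤ} (hn : s.var dimVar = n) (hB : n ≤ B)
    (hx : x ≠ dimVar ∧ x ≠ sumVar) (hz : e₀.eval s = z) (hz₀ : 0 ≤ z) (hF₀ : ∀ k, 0 ≤ F k)
    (hH : z + ∑ k, F k ≤ H)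
    (hF : ∀ (k : Fin n) s₁, Frame (sumTo x e₀ e) s s₁ → s₁.var sumVar = k → e.eval s₁ = F k) :
    Achieves H B (sumTo x e₀ e) s fun s' => s'.var x = z + ∑ k, F k := by
  have hle (A : Finset (Fin n)) : |z + ∑ k ∈ A, F k| ≤ H := by
    rw [abs_of_nonneg (add_nonneg hz₀ (A.sum_nonneg fun k _ => hF₀ k))]
    refine (add_le_add_right ?_ z).trans hH
    exact Finset.sum_le_univ_sum_of_nonneg hF₀
  refine (assign (Q := fun s₁ => s₁.var x = z) hz (by simpa using hle ∅) (by simp)).seq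
    fun s₁ hframe₁ hx₁ => ?_
  refine forTo (Inv := fun A s₂ => s₂.var x = z + ∑ k ∈ A, F k)
    ((hframe₁.var_eq _ (by simp [Prog.wvars, hx.1.symm])).trans hn) hB (by decide)
    (by simp [Prog.wvars, hx.2.symm]) (by simp [Prog.wvars, hx.1.symm])
    (fun A s z h => by simpa [hx.2] using h) (by simpa using hx₁)
    fun k A s₂ _ hframe₂ hk hkA hsum => ?_
  refine assign (z := z + ∑ k ∈ insert k A, F k) ?_ (hle _) (by simp)
  rw [Finset.sum_insert hkA, Expr.eval_add, hF k s₂ (hframe₁.seq_left.trans hframe₂.seq_right) hk,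
    Expr.eval_var, hsum]
  ring

theorem fillVector {a : ℕ} {e : Expr} {f : Fin n → ℤ} (hn : s.var dimVar = n) (hB : n ≤ B)
    (hp : ∀ x ∈ [dimVar, rowVar], x ∉ p.wvars) (ha : a ∉ p.warrs) (hH : ∀ i, |f i| ≤ H)
    (hstep : ∀ (i : Fin n) s₁, s₁.Within H → Frame (fillVector a p e) s s₁ → s₁.var rowVar = i →
      Achieves H B p s₁ fun s₂ => e.eval s₂ = f i) :
    Achieves H B (fillVector a p e) s fun s' => HoldsVector (s'.arr a) f := by
  simp only [List.forall_mem_cons, List.not_mem_nil, false_imp_iff, implies_true, and_true] at hp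
  refine (forTo (Inv := fun A s₁ => ∀ i ∈ A, s₁.arr a i = f i) hn hB (by decide)
    (by simpa [Prog.wvars] using hp.2) (by simpa [Prog.wvars] using hp.1) (by simp) (by simp)
    fun i A s₁ hs₁ hframe hi _ hinv => ?_).mono fun s' _ h i => h i (Finset.mem_univ i)
  refine (hstep i s₁ hs₁ hframe hi).seq fun s₂ hframe₂ he => ?_
  refine put ((hframe₂.var_eq _ hp.2).trans hi) he (hH i) fun k hk => ?_
  by_cases hki : k = i
  · simp [hki]
  · simpa [hki, Fin.val_inj, hframe₂.arr_eq a ha] using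
      hinv k (Finset.mem_of_mem_insert_of_ne hk hki)

theorem fillMatrix {a : ℕ} {e : Expr} {A : Matrix (Fin n) (Fin n) ℤ} (hn : s.var dimVar = n)
    (hB : n ≤ B) (hp : ∀ x ∈ [dimVar, rowVar, colVar], x ∉ p.wvars) (ha : a ∉ p.warrs)
    (hH : ∀ i j, |A i j| ≤ H)
    (hstep : ∀ (i j : Fin n) s₁, s₁.Within H → Frame (fillMatrix a p e) s s₁ →
      s₁.var rowVar = i → s₁.var colVar = j → Achieves H B p s₁ fun s₂ => e.eval s₂ = A i j) :
    Achieves H B (fillMatrix a p e) s fun s' => HoldsMatrix (s'.arr a) A := by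
  refine (forMatrix (Inv := fun S s₁ => ∀ c ∈ S, s₁.arr a (c.1 * n + c.2) = A c.1 c.2) hn hB
    (by simpa [Prog.wvars] using hp) (by simp) (by simp)
    fun i j S s₁ hs₁ hframe hi hj _ hinv => ?_).mono fun s' _ h i j => h (i, j) (Finset.mem_univ _)
  have hdim : s₁.var dimVar = n := by
    refine (hframe.var_eq _ ?_).trans hn
    simpa [LogRAM.forMatrix, LogRAM.forTo, Prog.wvars] using hp _ (by simp)
  refine (hstep i j s₁ hs₁ hframe hi hj).seq fun s₂ hframe₂ he => ?_
  have hvar (x : ℕ) (hx : x ∈ [dimVar, rowVar, colVar]) : s₂.var x = s₁.var x :=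
    hframe₂.var_eq x (hp x hx)
  refine put (y := i * n + j) (by simp [hvar, hdim, hi, hj]) he (hH i j) fun c hc => ?_
  by_cases hcij : c = (i, j)
  · simp [hcij]
  · have hne : (c.1 : ℤ) * n + c.2 ≠ i * n + j := fun h =>
      hcij (Prod.ext (row_mul_add_injective h).1 (row_mul_add_injective h).2)
    simpa [hne, hframe₂.arr_eq a ha] using hinv c (Finset.mem_of_mem_insert_of_ne hc hcij)

end Achieves
end LogRAM

/-! ## The algorithm -/

namespace LogRAM

open LogRAM.Expr (var get)

-- Arrays `0`, `1` and `2` are the input of `GraphMatrixInput.load`, array `3` holds the unused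
-- random bits, and `GraphMatrixInput.output` reads array `4`.
abbrev adjArr : ℕ := 0
abbrev numArr : ℕ := 1
abbrev denArr : ℕ := 2
abbrev outArr : ℕ := 4
abbrev intArr : ℕ := 5
abbrev tabArr : ℕ := 6
abbrev nextTabArr : ℕ := 7
abbrev basisArr : ℕ := 8
abbrev errArr : ℕ := 9
abbrev cellArr : ℕ := 10
abbrev memberArr : ℕ := 11

abbrev accVar : ℕ := 4
abbrev denVar : ℕ := 5
abbrev maxVar : ℕ := 6
abbrev detVar : ℕ := 7
abbrev foundVar : ℕ := 8
abbrev pivotRowVar : ℕ := 9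
abbrev pivotColVar : ℕ := 10
abbrev rankVar : ℕ := 11
abbrev resVar : ℕ := 12
abbrev sizeVar : ℕ := 13
abbrev bestVar : ℕ := 14

/-- Compute the product of the denominators in `denVar`. -/
def commonDenominator : Prog :=
  denVar ::= 1 ;;
  forMatrix (denVar ::= var denVar * entry denArr rowVar colVar)

/-- Clear the denominators of the input matrix; the result is `intArr`. -/
def clearDenominators : Prog :=
  fillMatrix intArr .skip (entry numArr rowVar colVar *
    (var denVar / entry denArr rowVar colVar))

/-- Compute the largest absolute value of an entry of `intArr` in `maxVar`. -/
def maxAbsEntry : Prog :=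
  maxVar ::= 0 ;;
  forMatrix (
    accVar ::= entry intArr rowVar colVar ;;
    .ite (0 - var accVar) (accVar ::= 0 - var accVar) .skip ;;
    .ite (var accVar - var maxVar) (maxVar ::= var accVar) .skip)

/-- The largest absolute value of an entry of an integer matrix. -/
def maxAbs {n : ℕ} (N : Matrix (Fin n) (Fin n) ℤ) : ℕ :=
  Finset.univ.sup fun c : Fin n × Fin n => (N c.1 c.2).natAbs

section Scaling

variable {n H B : ℕ} {s : State}

theorem achieves_commonDenominator {den : Matrix (Fin n) (Fin n) ℤ} (hn : s.var dimVar = n)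
    (hB : n ≤ B) (hden : HoldsMatrix (s.arr denArr) den) (hpos : ∀ i j, 0 < den i j)
    (hH : ∏ c : Fin n × Fin n, den c.1 c.2 ≤ H) :
    Achieves H B commonDenominator s fun s' =>
      s'.var denVar = ∏ c : Fin n × Fin n, den c.1 c.2 := by
  have hle (S : Finset (Fin n × Fin n)) : |∏ c ∈ S, den c.1 c.2| ≤ H := by
    rw [abs_of_pos (Finset.prod_pos fun c _ => hpos _ _)]
    refine le_trans ?_ hH
    exact Finset.prod_le_prod_of_subset_of_one_le (Finset.subset_univ S)
      (fun c _ => (hpos _ _).le) fun c _ _ => hpos _ _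
  refine (Achieves.assign (Q := fun s₁ => s₁.var denVar = 1) rfl (by simpa using hle ∅)
    (by simp)).seq fun s₁ hframe₁ h₁ => ?_
  refine Achieves.forMatrix (Inv := fun S s₂ => s₂.var denVar = ∏ c ∈ S, den c.1 c.2)
    (hframe₁.var hn) hB (by decide) (by simp) (by simpa using h₁)
    fun i j S s₂ _ hframe₂ hi hj hij h₂ => ?_
  refine Achieves.assign (z := ∏ c ∈ insert (i, j) S, den c.1 c.2) ?_ (hle _) (by simp)
  rw [Expr.eval_mul, Expr.eval_var, h₂, Finset.prod_insert hij, mul_comm]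
  congr 1
  exact ((hden.of_frame hframe₁).of_frame hframe₂).eval_entry (hframe₂.var (hframe₁.var hn)) hi hj

theorem achieves_clearDenominators {num den : Matrix (Fin n) (Fin n) ℤ} {L : ℤ}
    (hn : s.var dimVar = n) (hB : n ≤ B) (hnum : HoldsMatrix (s.arr numArr) num)
    (hden : HoldsMatrix (s.arr denArr) den) (hL : s.var denVar = L)
    (hH : ∀ i j, |num i j * (L / den i j)| ≤ H) :
    Achieves H B clearDenominators s fun s' =>
      HoldsMatrix (s'.arr intArr) fun i j => num i j * (L / den i j) := by
  refine Achieves.fillMatrix hn hB (by decide) (by decide) hH fun i j s₁ _ hframe hi hj =>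
    Achieves.skip ?_
  rw [Expr.eval_mul, Expr.eval_div, (hnum.of_frame hframe).eval_entry (hframe.var hn) hi hj,
    (hden.of_frame hframe).eval_entry (hframe.var hn) hi hj, Expr.eval_var, hframe.var hL]

theorem achieves_maxAbsEntry {N : Matrix (Fin n) (Fin n) ℤ} (hn : s.var dimVar = n) (hB : n ≤ B)
    (hN : HoldsMatrix (s.arr intArr) N) (hH : ∀ i j, |N i j| ≤ H) :
    Achieves H B maxAbsEntry s fun s' => s'.var maxVar = maxAbs N := by
  refine (Achieves.assign (Q := fun s₁ => s₁.var maxVar = 0) rfl (by simp) (by simp)).seq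
    fun s₁ hframe₁ h₁ => ?_
  refine Achieves.forMatrix
    (Inv := fun S s₂ => s₂.var maxVar = (S.sup fun c => (N c.1 c.2).natAbs : ℕ))
    (hframe₁.var hn) hB (by decide) (by simp) (by simpa using h₁)
    fun i j S s₂ _ hframe₂ hi hj _ h₂ => ?_
  have hentry := ((hN.of_frame hframe₁).of_frame hframe₂).eval_entry
    (hframe₂.var (hframe₁.var hn)) hi hj
  refine (Achieves.assign (Q := fun s₃ => s₃.var accVar = N i j) hentry (hH i j) (by simp)).seq
    fun s₃ hframe₃ h₃ => ?_
  refine (Achieves.ite (Q := fun s₄ => s₄.var accVar = |N i j|) (fun hneg => ?_)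
    (fun hnonneg => Achieves.skip ?_)).seq fun s₄ hframe₄ h₄ => ?_
  · rw [Expr.eval_sub, Expr.eval_var, h₃] at hneg
    have hneg : N i j < 0 := by simpa using hneg
    exact Achieves.assign (z := |N i j|) (by simp [h₃, abs_of_neg hneg]) (by simpa using hH i j)
      (by simp)
  · rw [h₃, abs_of_nonneg]
    simpa [h₃] using hnonneg
  · have hmax := hframe₄.var (hframe₃.var h₂)
    rw [Finset.sup_insert, Nat.cast_max, Int.natCast_natAbs]
    refine Achieves.ite (fun hlt => ?_) (fun hle => Achieves.skip ?_)
    · have hlt := by simpa [h₄, hmax] using hlt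
      exact Achieves.assign h₄ (by simpa using hH i j) (by simp [hlt.le])
    · have hle := by simpa [h₄, hmax] using hle
      rw [hmax, max_eq_right hle]

end Scaling

end LogRAM

namespace LogRAM

open LogRAM.Expr (var get)

/-- Set up the tableau of the basis of unit vectors. The array `basisArr` holds `p + 1` at each
position of a basis that holds row `p`, and `0` at the positions of unit vectors. -/
def initBasis : Prog :=
  fillMatrix tabArr .skip (entry intArr rowVar colVar) ;;
  fillVector basisArr .skip 0 ;;
  detVar ::= 1

/-- Record the current row and column as a pivot. -/
def recordPivot : Prog :=
  pivotRowVar ::= var rowVar ;; pivotColVar ::= var colVar ;; foundVar ::= 1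

/-- Search for an exchange that improves the basis. -/
def findPivot : Prog :=
  foundVar ::= 0 ;;
  forMatrix (.ite (get basisArr (var colVar))
    (.ite (4 * entry tabArr rowVar colVar * entry tabArr rowVar colVar -
      9 * var detVar * var detVar) recordPivot .skip)
    (.ite (entry tabArr rowVar colVar * entry tabArr rowVar colVar) recordPivot .skip))

/-- Compute the tableau of the basis after the recorded exchange without fractions. -/
def nextTableau : Prog :=
  fillMatrix nextTabArr
    (.ite ((var colVar - var pivotColVar) * (var colVar - var pivotColVar))
      (accVar ::= (entry tabArr rowVar colVar * entry tabArr pivotRowVar pivotColVar -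
        entry tabArr rowVar pivotColVar * entry tabArr pivotRowVar colVar) / var detVar)
      (accVar ::= entry tabArr rowVar colVar)) (var accVar)

/-- Carry out the recorded exchange. -/
def pivotStep : Prog :=
  nextTableau ;;
  detVar ::= entry tabArr pivotRowVar pivotColVar ;;
  fillMatrix tabArr .skip (entry nextTabArr rowVar colVar) ;;
  .put basisArr (var pivotColVar) (var pivotRowVar + 1)

/-- Pivot until no exchange improves the basis. -/
def pivotLoop : Prog :=
  initBasis ;; findPivot ;; .while (var foundVar) (pivotStep ;; findPivot)

section Pivoting

variable {n H B : ℕ} {s s' : State} {N : Matrix (Fin n) (Fin n) ℤ} {σ : Fin n → Option (Fin n)}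

/-- The memory holds the basis `σ` with its determinant and tableau. -/
structure HoldsBasis (N : Matrix (Fin n) (Fin n) ℤ) (σ : Fin n → Option (Fin n)) (s : State) :
    Prop where
  det : s.var detVar = (basisMatrix N σ).det
  tableau : HoldsMatrix (s.arr tabArr) (tableau N σ)
  basis : HoldsVector (s.arr basisArr) fun q => (σ q).elim 0 fun p => (p + 1 : ℤ)

/-- The memory records an improving exchange, unless there is none among the pairs in `S`. -/
def PivotSearch (N : Matrix (Fin n) (Fin n) ℤ) (σ : Fin n → Option (Fin n))
    (S : Finset (Fin n × Fin n)) (s : State) : Prop :=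
  (s.var foundVar = 0 ∧ ∀ c ∈ S, ¬ Improvable N σ c.1 c.2) ∨
    (s.var foundVar = 1 ∧ ∃ p q : Fin n, Improvable N σ p q ∧ s.var pivotRowVar = p ∧
      s.var pivotColVar = q)

theorem HoldsBasis.of_frame {p : Prog} (h : HoldsBasis N σ s) (hframe : Frame p s s')
    (hv : detVar ∉ p.wvars := by decide) (ht : tabArr ∉ p.warrs := by decide)
    (hb : basisArr ∉ p.warrs := by decide) : HoldsBasis N σ s' :=
  ⟨hframe.var h.det hv, h.tableau.of_frame hframe ht, h.basis.of_frame hframe hb⟩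

theorem HoldsBasis.basis_pos_iff (h : HoldsBasis N σ s) (q : Fin n) :
    0 < s.arr basisArr q ↔ (σ q).isSome := by
  rw [h.basis q]
  cases hq : σ q <;> simp [hq]

theorem abs_tableau_le (hdet : ∀ σ, |(basisMatrix N σ).det| ≤ H) (p q : Fin n) :
    |tableau N σ p q| ≤ H := by
  rw [tableau_apply]
  exact hdet _

theorem achieves_initBasis (hn : s.var dimVar = n) (hB : n ≤ B)
    (hN : HoldsMatrix (s.arr intArr) N) (hdet : ∀ σ, |(basisMatrix N σ).det| ≤ H) :
    Achieves H B initBasis s (HoldsBasis N fun _ => none) := by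
  have hH : (1 : ℤ) ≤ H := by simpa [basisMatrix_none] using hdet fun _ => none
  refine (Achieves.fillMatrix (A := tableau N fun _ => none) hn hB (by decide) (by decide)
    (abs_tableau_le hdet) fun i j s₁ _ hframe hi hj => Achieves.skip ?_).seq
    fun s₁ hframe₁ htab => ?_
  · rw [tableau_none, (hN.of_frame hframe).eval_entry (hframe.var hn) hi hj]
  refine (Achieves.fillVector (f := fun _ : Fin n => 0) (hframe₁.var hn) hB (by decide) (by decide)
    (by simp) fun i s₂ _ _ _ => Achieves.skip rfl).seq fun s₂ hframe₂ hbasis => ?_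
  exact Achieves.assign rfl (by simpa using hH)
    ⟨by simp [basisMatrix_none], by simpa using htab.of_frame hframe₂, by simpa using hbasis⟩

theorem achieves_recordPivot {p q : Fin n} {S : Finset (Fin n × Fin n)}
    (hn : s.var dimVar = n) (h : Improvable N σ p q) (hp : s.var rowVar = p)
    (hq : s.var colVar = q) :
    Achieves H B recordPivot s (PivotSearch N σ S) := by
  refine .of_within fun hs => ?_
  have hnH : (n : ℤ) ≤ H := by simpa [hn] using hs.abs_var_le dimVar
  have hH (k : Fin n) : |(k : ℤ)| ≤ H := by
    rw [Nat.abs_cast]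
    omega
  refine (Achieves.assign (e := var rowVar) (Q := fun s₁ => s₁.var pivotRowVar = p) hp (hH p)
    (by simp)).seq fun s₁ hframe₁ hp₁ => ?_
  refine (Achieves.assign (e := var colVar) (Q := fun s₂ => s₂.var pivotColVar = q)
    (hframe₁.var hq) (hH q) (by simp)).seq fun s₂ hframe₂ hq₂ => ?_
  exact Achieves.assign (z := 1) rfl (by rw [abs_one]; have := p.pos; omega)
    (Or.inr ⟨by simp, p, q, h, by simpa using hframe₂.var hp₁, by simpa using hq₂⟩)

theorem achieves_findPivot (hn : s.var dimVar = n) (hB : n ≤ B) (hs : HoldsBasis N σ s) :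
    Achieves H B findPivot s (PivotSearch N σ Finset.univ) := by
  refine (Achieves.assign (Q := PivotSearch N σ ∅) (z := 0) rfl (by simp)
    (Or.inl (by simp))).seq fun s₁ hframe₁ h₁ => ?_
  refine Achieves.forMatrix (Inv := PivotSearch N σ) (hframe₁.var hn) hB (by decide)
    (fun S s z => by simp [PivotSearch]) h₁ fun i j S s₂ _ hframe₂ hi hj _ h₂ => ?_
  have hb := (hs.of_frame hframe₁).of_frame hframe₂
  have hn₂ := hframe₂.var (hframe₁.var hn)
  have hT := hb.tableau.eval_entry hn₂ hi hj
  have hskip (h : ¬ Improvable N σ i j) :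
      Achieves H B .skip s₂ (PivotSearch N σ (insert (i, j) S)) := by
    refine Achieves.skip (h₂.imp_left fun h₀ => ⟨h₀.1, fun c hc => ?_⟩)
    rcases Finset.mem_insert.1 hc with rfl | hc
    exacts [h, h₀.2 c hc]
  refine Achieves.ite (fun hpos => ?_) (fun hnonpos => ?_)
  · have hj_some : (σ j).isSome := (hb.basis_pos_iff j).1 (by simpa [hj] using hpos)
    have hiff : Improvable N σ i j ↔ 0 < (4 * entry tabArr rowVar colVar *
        entry tabArr rowVar colVar - 9 * var detVar * var detVar).eval s₂ := by
      simp only [Expr.eval_sub, Expr.eval_mul, Expr.eval_ofNat, Expr.eval_var, hT, hb.det,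
        Improvable, hj_some, if_true, sub_pos, sq, mul_assoc, Nat.cast_ofNat]
    exact Achieves.ite (fun h => achieves_recordPivot hn₂ (hiff.2 h) hi hj)
      fun h => hskip (hiff.not.2 h.not_gt)
  · have hj_none : ¬ (σ j).isSome := by
      rw [← hb.basis_pos_iff j]
      simpa [hj] using hnonpos
    have hiff : Improvable N σ i j ↔
        0 < (entry tabArr rowVar colVar * entry tabArr rowVar colVar).eval s₂ := by
      rw [Expr.eval_mul, hT, mul_self_pos, Improvable, if_neg hj_none]
    exact Achieves.ite (fun h => achieves_recordPivot hn₂ (hiff.2 h) hi hj)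
      fun h => hskip (hiff.not.2 h.not_gt)

theorem achieves_nextTableau {p q : Fin n} (hn : s.var dimVar = n) (hB : n ≤ B)
    (hs : HoldsBasis N σ s) (hD : (basisMatrix N σ).det ≠ 0) (hT : tableau N σ p q ≠ 0)
    (hp : s.var pivotRowVar = p) (hq : s.var pivotColVar = q)
    (hdet : ∀ σ, |(basisMatrix N σ).det| ≤ H) :
    Achieves H B nextTableau s fun s' =>
      HoldsMatrix (s'.arr nextTabArr) (tableau N (Function.update σ q (some p))) := by
  refine Achieves.fillMatrix hn hB (by decide) (by decide) (abs_tableau_le hdet)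
    fun i j s₁ _ hframe hi hj => ?_
  have hb := hs.of_frame hframe
  have hentry {x y : ℕ} {k l : Fin n} (hx : s₁.var x = k) (hy : s₁.var y = l) :=
    hb.tableau.eval_entry (hframe.var hn) hx hy
  have hp := hframe.var hp
  have hq := hframe.var hq
  refine Achieves.ite (fun hne => ?_) (fun heq => ?_)
  · have hjq : j ≠ q := by
      rintro rfl
      simp [hj, hq] at hne
    refine Achieves.assign (z := tableau N (Function.update σ q (some p)) i j) ?_
      (abs_tableau_le hdet i j) (by simp)
    rw [Expr.eval_div, Expr.eval_sub, Expr.eval_mul, Expr.eval_mul, hentry hi hj, hentry hp hq,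
      hentry hi hq, hentry hp hj, Expr.eval_var, hb.det, ← det_mul_tableau_update hT i hjq,
      Int.mul_ediv_cancel_left _ hD]
  · have hjq : j = q := by
      have h0 : ((j : ℤ) - q) * (j - q) = 0 :=
        le_antisymm (by simpa [hj, hq] using heq) (mul_self_nonneg _)
      exact Fin.ext (by exact_mod_cast sub_eq_zero.1 (mul_self_eq_zero.1 h0))
    subst hjq
    exact Achieves.assign ((hentry hi hj).trans (tableau_update_self N σ p i j).symm)
      (abs_tableau_le hdet i j) (by simp)

theorem achieves_pivotStep {p q : Fin n} (hn : s.var dimVar = n) (hB : n ≤ B)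
    (hs : HoldsBasis N σ s) (hD : (basisMatrix N σ).det ≠ 0) (hT : tableau N σ p q ≠ 0)
    (hp : s.var pivotRowVar = p) (hq : s.var pivotColVar = q)
    (hdet : ∀ σ, |(basisMatrix N σ).det| ≤ H) :
    Achieves H B pivotStep s (HoldsBasis N (Function.update σ q (some p))) := by
  refine .of_within fun hsH => ?_
  have hnH : (n : ℤ) ≤ H := by simpa [hn] using hsH.abs_var_le dimVar
  refine (achieves_nextTableau hn hB hs hD hT hp hq hdet).seq fun s₁ hframe₁ htab₁ => ?_
  refine (Achieves.assign (Q := fun s₂ => s₂.var detVar = tableau N σ p q)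
    ((hs.tableau.of_frame hframe₁).eval_entry (hframe₁.var hn) (hframe₁.var hp) (hframe₁.var hq))
    (abs_tableau_le hdet p q) (by simp)).seq fun s₂ hframe₂ hdet₂ => ?_
  refine (Achieves.fillMatrix (A := tableau N (Function.update σ q (some p)))
    (hframe₂.var (hframe₁.var hn)) hB (by decide) (by decide) (abs_tableau_le hdet)
    fun i j s₃ _ hframe₃ hi hj => Achieves.skip (((htab₁.of_frame hframe₂).of_frame
      hframe₃).eval_entry (hframe₃.var (hframe₂.var (hframe₁.var hn))) hi hj)).seq
    fun s₃ hframe₃ htab₃ => ?_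
  have hbasis₃ := ((hs.basis.of_frame hframe₁).of_frame hframe₂).of_frame hframe₃
  refine Achieves.put (z := p + 1) (hframe₃.var (hframe₂.var (hframe₁.var hq)))
    (by simp [hframe₃.var (hframe₂.var (hframe₁.var hp))])
    (by rw [abs_of_nonneg (by positivity)]; omega) ⟨?_, by simpa using htab₃, fun k => ?_⟩
  · simpa [← tableau_apply] using hframe₃.var hdet₂
  · by_cases hk : k = q
    · simp [hk]
    · simpa [hk, Fin.val_inj] using hbasis₃ k

/-- A bound on the number of pivots that may still follow, if `K` exceeds the binary logarithms of
the squared determinants: a pivot raises the number of row positions, or else it at least doubles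
the squared determinant. -/
def pivotPotential (N : Matrix (Fin n) (Fin n) ℤ) (K : ℕ) (σ : Fin n → Option (Fin n)) : ℕ :=
  (n + 1) * K - (Fintype.card (RowPosition σ) * K + Nat.log 2 ((basisMatrix N σ).det.natAbs ^ 2))

theorem pivotPotential_update_lt {K : ℕ} {p q : Fin n}
    (hK : ∀ σ, Nat.log 2 ((basisMatrix N σ).det.natAbs ^ 2) < K) (hD : (basisMatrix N σ).det ≠ 0)
    (h : Improvable N σ p q) :
    pivotPotential N K (Function.update σ q (some p)) < pivotPotential N K σ := by
  set σ' := Function.update σ q (some p)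
  have hcard : Fintype.card (RowPosition σ') ≤ n :=
    (Fintype.card_subtype_le _).trans (Fintype.card_fin n).le
  have hmul := Nat.mul_le_mul_right K hcard
  suffices hlt : Fintype.card (RowPosition σ) * K + Nat.log 2 ((basisMatrix N σ).det.natAbs ^ 2) <
      Fintype.card (RowPosition σ') * K + Nat.log 2 ((basisMatrix N σ').det.natAbs ^ 2) by
    have := hK σ'
    unfold pivotPotential
    rw [add_one_mul]
    omega
  rw [card_rowPosition_update]
  unfold Improvable at h
  split_ifs at h ⊢ with hq
  · rw [tableau_apply] at h
    have hdouble : (basisMatrix N σ).det.natAbs ^ 2 * 2 ≤ (basisMatrix N σ').det.natAbs ^ 2 := by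
      zify
      rw [sq_abs, sq_abs]
      linarith [sq_nonneg (basisMatrix N σ).det]
    have hlog := Nat.log_mono_right (b := 2) hdouble
    rw [Nat.log_mul_base one_lt_two (by simpa using hD)] at hlog
    rw [add_zero]
    omega
  · have := hK σ
    rw [add_one_mul]
    omega

theorem log_sq_det_lt (hdet : ∀ σ, |(basisMatrix N σ).det| ≤ H) (σ : Fin n → Option (Fin n)) :
    Nat.log 2 ((basisMatrix N σ).det.natAbs ^ 2) < 2 * H.size + 1 := by
  refine Nat.lt_succ_of_le ((Nat.log_mono_right ?_).trans_eq (Nat.log_pow one_lt_two _))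
  rw [mul_comm, pow_mul]
  refine Nat.pow_le_pow_left ((Nat.lt_size_self H).le.trans' ?_) 2
  rw [← Int.ofNat_le, Int.natCast_natAbs]
  exact hdet σ

theorem achieves_pivotLoop (hn : s.var dimVar = n) (hN : HoldsMatrix (s.arr intArr) N)
    (hdet : ∀ σ, |(basisMatrix N σ).det| ≤ H) (hB : (n + 1) * (2 * H.size + 1) ≤ B) :
    Achieves H B pivotLoop s fun s' => ∃ σ, IsApproxSpanner N σ ∧ HoldsBasis N σ s' := by
  have hnB : n ≤ B := by nlinarith
  refine (achieves_initBasis hn hnB hN hdet).seq fun s₁ hframe₁ h₁ => ?_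
  refine (achieves_findPivot (hframe₁.var hn) hnB h₁).seq fun s₂ hframe₂ h₂ => ?_
  have hn₂ := hframe₂.var (hframe₁.var hn)
  refine (Achieves.while_of_measure (μ := pivotPotential N (2 * H.size + 1) fun _ => none)
    (fun μ s₃ => ∃ σ, μ = pivotPotential N (2 * H.size + 1) σ ∧ (basisMatrix N σ).det ≠ 0 ∧
      HoldsBasis N σ s₃ ∧ PivotSearch N σ Finset.univ s₃) ((Nat.sub_le _ _).trans hB)
    ⟨_, rfl, by simp [basisMatrix_none], h₁.of_frame hframe₂, h₂⟩ ?_).mono ?_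
  · rintro _ s₃ - hframe₃ ⟨σ, rfl, hD, hb, hsearch⟩ hpos
    obtain ⟨h0, -⟩ | ⟨-, p, q, himp, hp, hq⟩ := hsearch
    · simp [h0] at hpos
    have hT := himp.tableau_ne_zero
    refine (achieves_pivotStep (hframe₃.var hn₂) hnB hb hD hT hp hq hdet).seq
      fun s₄ hframe₄ h₄ => ?_
    refine (achieves_findPivot (hframe₄.var (hframe₃.var hn₂)) hnB h₄).mono
      fun s₅ hframe₅ h₅ => ⟨_, pivotPotential_update_lt (log_sq_det_lt hdet) hD himp, _, rfl, ?_,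
        h₄.of_frame hframe₅, h₅⟩
    rwa [← tableau_apply]
  · rintro s' - ⟨⟨_, σ, -, hD, hb, hsearch⟩, hle⟩
    obtain ⟨-, hnot⟩ | ⟨h1, -⟩ := hsearch
    · exact ⟨σ, ⟨hD, fun p q => hnot (p, q) (Finset.mem_univ _)⟩, hb⟩
    · simp [h1] at hle

end Pivoting

end LogRAM

namespace LogRAM

open LogRAM.Expr (var get)

/-- Count the row positions of the basis in `rankVar`. -/
def computeRank : Prog :=
  -- each quotient is `1`, or `0 / 0 = 0`
  sumTo rankVar 0 (get basisArr (var sumVar) / get basisArr (var sumVar))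

/-- Double the resolution of the grid until it satisfies `IsResolution`. -/
def findResolution : Prog :=
  resVar ::= 1 ;;
  .while (3 * var rankVar * var maxVar - var resVar * var resVar * var denVar)
    (resVar ::= var resVar + var resVar)

/-- Compute the scaled row errors in `errArr`. -/
def computeErrors : Prog :=
  fillVector errArr
    (sumTo accVar
      ((entry intArr rowVar rowVar - var denVar) * (entry intArr rowVar rowVar - var denVar))
      (entry adjArr rowVar sumVar * (entry intArr rowVar sumVar * entry intArr rowVar sumVar)))
    (var accVar)

/-- Compute the cells of all vertices in `cellArr`. -/
def computeCells : Prog :=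
  fillMatrix cellArr
    (.ite (get basisArr (var colVar))
      (accVar ::= get basisArr (var colVar) - 1 ;;
        accVar ::= 2 * var resVar * (var maxVar * entry tabArr rowVar colVar +
          var detVar * entry intArr accVar rowVar) * var detVar /
            (5 * var maxVar * var detVar * var detVar))
      (accVar ::= 0)) (var accVar)

/-- Compute the indicator vectors of the good vertices in each cell in `memberArr`. -/
def computeMembers : Prog :=
  fillMatrix memberArr
    (sumTo accVar 0 ((entry cellArr rowVar sumVar - entry cellArr colVar sumVar) *
        (entry cellArr rowVar sumVar - entry cellArr colVar sumVar)) ;;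
      .ite (1 - var accVar)
        (.ite (var denVar * var denVar - 4 * get errArr (var colVar)) (accVar ::= 1) (accVar ::= 0))
        (accVar ::= 0)) (var accVar)

/-- Find the row of `memberArr` with the largest sum. -/
def findBestRow : Prog :=
  sizeVar ::= 0 ;;
  forTo rowVar
    (sumTo accVar 0 (entry memberArr rowVar sumVar) ;;
      .ite (var accVar + 1 - var sizeVar) (sizeVar ::= var accVar ;; bestVar ::= var rowVar) .skip)

/-- Output the largest row of `memberArr`. -/
def outputBestRow : Prog :=
  findBestRow ;; fillVector outArr .skip (entry memberArr bestVar rowVar)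

/-- A resolution for the rank `r` and the bound `C / L` that is fine enough to separate adjacent
good vertices, and no finer than the number of cells allows. -/
structure IsResolution (r C L m : ℕ) : Prop where
  pos : 0 < m
  le : 3 * r * C ≤ m ^ 2 * L
  eq_one_or_lt : m = 1 ∨ m ^ 2 * L < 12 * r * C

theorem IsResolution.sq_le {r C L m : ℕ} (h : IsResolution r C L m) (hL : 0 < L) :
    m ^ 2 ≤ 12 * r * C + 1 := by
  obtain rfl | hlt := h.eq_one_or_lt
  · simp
  · nlinarith [Nat.le_mul_of_pos_right (m ^ 2) hL]

/-- The error of row `i` of the matrix `N / L`, multiplied by `L ^ 2`. -/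
def scaledRowError {n : ℕ} (G : SimpleGraph (Fin n)) [DecidableRel G.Adj]
    (N : Matrix (Fin n) (Fin n) ℤ) (L : ℤ) (i : Fin n) : ℤ :=
  (N i i - L) * (N i i - L) + ∑ j, G.adjMatrix ℤ i j * (N i j * N i j)

/-- The cells of the vertices in integer arithmetic: `C / L` bounds the entries of the matrix
`N / L`, and the positions of unit vectors in the basis contribute zero. The denominator contains
the square of the determinant because integer division rounds down only for positive divisors. -/
def gridCell {n : ℕ} (N : Matrix (Fin n) (Fin n) ℤ) (σ : Fin n → Option (Fin n)) (C m : ℤ)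
    (i q : Fin n) : ℤ :=
  (σ q).elim 0 fun p => 2 * m * (C * tableau N σ i q + (basisMatrix N σ).det * N p i) *
    (basisMatrix N σ).det / (5 * C * (basisMatrix N σ).det * (basisMatrix N σ).det)

section Clustering

variable {n H B : ℕ} {s s' : State} {G : SimpleGraph (Fin n)} [DecidableRel G.Adj]
  {N : Matrix (Fin n) (Fin n) ℤ} {L : ℕ} {σ : Fin n → Option (Fin n)}

/-- The memory holds the graph `G` and the matrix `N / L`. -/
structure HoldsScaledInput (G : SimpleGraph (Fin n)) [DecidableRel G.Adj]
    (N : Matrix (Fin n) (Fin n) ℤ) (L : ℕ) (s : State) : Prop where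
  dim : s.var dimVar = n
  den : s.var denVar = L
  max : s.var maxVar = maxAbs N
  adj : HoldsMatrix (s.arr adjArr) (G.adjMatrix ℤ)
  int : HoldsMatrix (s.arr intArr) N

theorem HoldsScaledInput.of_frame {p : Prog} (h : HoldsScaledInput G N L s) (hframe : Frame p s s')
    (hv : ∀ x ∈ [dimVar, denVar, maxVar], x ∉ p.wvars := by decide)
    (ha : ∀ a ∈ [adjArr, intArr], a ∉ p.warrs := by decide) : HoldsScaledInput G N L s' :=
  ⟨hframe.var h.dim (hv _ (by simp)), hframe.var h.den (hv _ (by simp)),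
    hframe.var h.max (hv _ (by simp)), h.adj.of_frame hframe (ha _ (by simp)),
    h.int.of_frame hframe (ha _ (by simp))⟩

theorem achieves_computeRank (hn : s.var dimVar = n) (hB : n ≤ B) (hs : HoldsBasis N σ s) :
    Achieves H B computeRank s fun s' => s'.var rankVar = Fintype.card (RowPosition σ) := by
  refine .of_within fun hsH => ?_
  have hnH : (n : ℤ) ≤ H := by simpa [hn] using hsH.abs_var_le dimVar
  have hcard : ∑ q, (if (σ q).isSome then 1 else 0 : ℤ) = Fintype.card (RowPosition σ) := by
    rw [Finset.sum_boole, Fintype.card_subtype]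
  have hcard_le : Fintype.card (RowPosition σ) ≤ n :=
    (Fintype.card_subtype_le _).trans (Fintype.card_fin n).le
  rw [← hcard]
  refine (Achieves.sumTo (z := 0) (F := fun q => if (σ q).isSome then 1 else 0) hn hB (by decide)
    rfl le_rfl (fun q => by positivity) (by rw [hcard]; omega) fun q s₁ hframe hq => ?_).mono
    fun s' _ h => by rw [h, zero_add]
  rw [Expr.eval_div, (hs.basis.of_frame hframe).eval_get hq]
  cases hσ : σ q
  · simp
  · simpa using Int.ediv_self (by positivity)

theorem achieves_findResolution {r C : ℕ} (hr : s.var rankVar = r) (hC : s.var maxVar = C)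
    (hL : s.var denVar = L) (hL₀ : 0 < L) (hH : 12 * r * C < H) (hB : H.size ≤ B) :
    Achieves H B findResolution s fun s' => ∃ m : ℕ,
      s'.var resVar = m ∧ IsResolution r C L m := by
  refine (Achieves.assign (Q := fun s₁ => s₁.var resVar = 1) (z := 1) rfl (by rw [abs_one]; omega)
    (by simp)).seq fun s₁ hframe₁ h₁ => ?_
  refine (Achieves.while_of_measure (fun μ s₂ => ∃ k, μ = H.size - k ∧
    s₂.var resVar = (2 ^ k : ℕ) ∧ (2 ^ k = 1 ∨ (2 ^ k) ^ 2 * L < 12 * r * C)) hB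
    ⟨0, rfl, by simpa using h₁, Or.inl rfl⟩ ?_).mono ?_
  · rintro _ s₂ - hframe₂ ⟨k, rfl, hk, -⟩ hpos
    have hlt : (2 ^ k) ^ 2 * L < 3 * r * C := by
      have hr₂ := hframe₂.var (hframe₁.var hr)
      have hC₂ := hframe₂.var (hframe₁.var hC)
      have hL₂ := hframe₂.var (hframe₁.var hL)
      simp only [Expr.eval_sub, Expr.eval_mul, Expr.eval_var, Expr.eval_ofNat, hk, hr₂, hC₂, hL₂,
        sub_pos] at hpos
      rw [sq]
      exact_mod_cast hpos
    have hlt' : (2 ^ (k + 1)) ^ 2 * L < 12 * r * C := by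
      calc (2 ^ (k + 1)) ^ 2 * L = 4 * ((2 ^ k) ^ 2 * L) := by ring
        _ < 12 * r * C := by linarith
    have hle : 2 ^ (k + 1) ≤ H := by
      nlinarith [Nat.le_mul_of_pos_right ((2 ^ (k + 1)) ^ 2) hL₀, Nat.one_le_two_pow (n := k + 1)]
    have hsize := Nat.lt_size.2 hle
    refine Achieves.assign (z := (2 ^ (k + 1) : ℕ)) ?_ (by rw [Nat.abs_cast]; exact_mod_cast hle)
      ⟨_, by omega, k + 1, rfl, by simp, Or.inr hlt'⟩
    rw [Expr.eval_add, Expr.eval_var, hk]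
    push_cast
    ring
  · rintro s' hframe ⟨⟨_, k, -, hk, hlt⟩, hle⟩
    refine ⟨2 ^ k, hk, by positivity, ?_, hlt⟩
    have hr' := hframe.var (hframe₁.var hr)
    have hC' := hframe.var (hframe₁.var hC)
    have hL' := hframe.var (hframe₁.var hL)
    simp only [Expr.eval_sub, Expr.eval_mul, Expr.eval_var, Expr.eval_ofNat, hk, hr', hC', hL',
      sub_nonpos] at hle
    rw [sq]
    exact_mod_cast hle

theorem scaledRowError_nonneg (i : Fin n) : 0 ≤ scaledRowError G N L i :=
  add_nonneg (mul_self_nonneg _) (Finset.sum_nonneg fun j _ =>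
    mul_nonneg (by rw [SimpleGraph.adjMatrix_apply]; positivity) (mul_self_nonneg _))

theorem achieves_computeErrors (hB : n ≤ B) (hs : HoldsScaledInput G N L s)
    (hH : ∀ i, scaledRowError G N L i ≤ H) :
    Achieves H B computeErrors s fun s' =>
      HoldsVector (s'.arr errArr) (scaledRowError G N L) := by
  refine Achieves.fillVector hs.dim hB (by decide) (by decide)
    (fun i => by rw [abs_of_nonneg (scaledRowError_nonneg i)]; exact hH i)
    fun i s₁ _ hframe₁ hi => ?_
  have h₁ := hs.of_frame hframe₁
  refine Achieves.sumTo (F := fun j => G.adjMatrix ℤ i j * (N i j * N i j)) h₁.dim hB (by decide)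
    ?_ (mul_self_nonneg _) (fun j => mul_nonneg ?_ (mul_self_nonneg _)) (hH i)
    fun j s₂ hframe₂ hj => ?_
  · rw [Expr.eval_mul, Expr.eval_sub, h₁.int.eval_entry h₁.dim hi hi, Expr.eval_var, h₁.den]
  · rw [SimpleGraph.adjMatrix_apply]
    positivity
  · have h₂ := h₁.of_frame hframe₂
    have hi₂ := hframe₂.var hi
    rw [Expr.eval_mul, Expr.eval_mul, h₂.adj.eval_entry h₂.dim hi₂ hj,
      h₂.int.eval_entry h₂.dim hi₂ hj]

theorem achieves_computeCells {m : ℕ} (hB : n ≤ B) (hs : HoldsScaledInput G N L s)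
    (hσ : HoldsBasis N σ s) (hm : s.var resVar = m)
    (hH : ∀ i q, |gridCell N σ (maxAbs N) m i q| ≤ H) :
    Achieves H B computeCells s fun s' =>
      HoldsMatrix (s'.arr cellArr) (gridCell N σ (maxAbs N) m) := by
  refine .of_within fun hsH => ?_
  have hnH : (n : ℤ) ≤ H := by simpa [hs.dim] using hsH.abs_var_le dimVar
  refine Achieves.fillMatrix hs.dim hB (by decide) (by decide) hH fun i q s₁ _ hframe₁ hi hq => ?_
  have h₁ := hs.of_frame hframe₁
  have hσ₁ := hσ.of_frame hframe₁
  have hbasis := hσ₁.basis.eval_get hq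
  cases hp : σ q with
  | none =>
    rw [hp, Option.elim_none] at hbasis
    refine Achieves.ite (fun hpos => absurd hbasis hpos.ne') fun _ => ?_
    exact Achieves.assign rfl (by simp) (by simp [gridCell, hp])
  | some p =>
    rw [hp, Option.elim_some] at hbasis
    refine Achieves.ite (fun _ => ?_) fun hle => absurd hle (by rw [hbasis]; omega)
    refine (Achieves.assign (Q := fun s₂ => s₂.var accVar = p) (z := p)
      (by rw [Expr.eval_sub, hbasis]; simp) (by rw [Nat.abs_cast]; omega) (by simp)).seq
      fun s₂ hframe₂ hacc => ?_
    have h₂ := h₁.of_frame hframe₂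
    have hσ₂ := hσ₁.of_frame hframe₂
    refine Achieves.assign ?_ (hH i q) (by simp)
    simp only [Expr.eval_div, Expr.eval_mul, Expr.eval_add, Expr.eval_var, Expr.eval_ofNat,
      hframe₂.var (hframe₁.var hm), h₂.max, hσ₂.det,
      hσ₂.tableau.eval_entry h₂.dim (hframe₂.var hi) (hframe₂.var hq),
      h₂.int.eval_entry h₂.dim hacc (hframe₂.var hi), gridCell, hp, Option.elim_some]
    norm_num

theorem sum_mul_self_sub_eq_zero_iff (f g : Fin n → ℤ) :
    ∑ q, (f q - g q) * (f q - g q) = 0 ↔ f = g := by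
  rw [Finset.sum_eq_zero_iff_of_nonneg fun q _ => mul_self_nonneg _, funext_iff]
  simp [sub_eq_zero]

theorem sum_mul_self_sub_le {m : ℤ} {f g : Fin n → ℤ} (hf : ∀ q, |f q| ≤ m)
    (hg : ∀ q, |g q| ≤ m) : ∑ q, (f q - g q) * (f q - g q) ≤ n * (2 * m) ^ 2 := by
  have hterm (q : Fin n) : (f q - g q) * (f q - g q) ≤ (2 * m) ^ 2 := by
    rw [← sq, two_mul]
    exact sq_le_sq' (by linarith [abs_le.1 (hf q), abs_le.1 (hg q)])
      (by linarith [abs_le.1 (hf q), abs_le.1 (hg q)])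
  simpa using Finset.sum_le_card_nsmul Finset.univ _ _ fun q _ => hterm q

theorem achieves_computeMembers {m : ℕ} {cell : Matrix (Fin n) (Fin n) ℤ} {err : Fin n → ℤ}
    (hn : s.var dimVar = n) (hB : n ≤ B) (hL : s.var denVar = L)
    (hcell : HoldsMatrix (s.arr cellArr) cell) (herr : HoldsVector (s.arr errArr) err)
    (hm : ∀ i q, |cell i q| ≤ m) (hH : n * (2 * m) ^ 2 < H) :
    Achieves H B computeMembers s fun s' => HoldsMatrix (s'.arr memberArr) fun k i =>
      if cell k = cell i ∧ 4 * err i < L * L then 1 else 0 := by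
  have hH₁ : (1 : ℤ) ≤ H := by omega
  refine Achieves.fillMatrix hn hB (by decide) (by decide)
    (fun k i => by split_ifs <;> simp [hH₁]) fun k i s₁ _ hframe₁ hk hi => ?_
  have hn₁ := hframe₁.var hn
  have hcell₁ := hcell.of_frame hframe₁
  refine (Achieves.sumTo (z := 0) (F := fun q => (cell k q - cell i q) * (cell k q - cell i q)) hn₁
    hB (by decide) rfl le_rfl (fun q => mul_self_nonneg _) ?_ fun q s₂ hframe₂ hq => ?_).seq
    fun s₂ hframe₂ hsum => ?_
  · rw [zero_add]
    exact (sum_mul_self_sub_le (hm k) (hm i)).trans (by exact_mod_cast hH.le)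
  · have hcell₂ := hcell₁.of_frame hframe₂
    rw [Expr.eval_mul, Expr.eval_sub, hcell₂.eval_entry (hframe₂.var hn₁) (hframe₂.var hk) hq,
      hcell₂.eval_entry (hframe₂.var hn₁) (hframe₂.var hi) hq]
  have heq : 0 < (1 - var accVar : Expr).eval s₂ ↔ cell k = cell i := by
    have hnonneg : 0 ≤ ∑ q, (cell k q - cell i q) * (cell k q - cell i q) :=
      Finset.sum_nonneg fun q _ => mul_self_nonneg _
    rw [← sum_mul_self_sub_eq_zero_iff, Expr.eval_sub, Expr.eval_var, hsum, zero_add,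
      Expr.eval_ofNat, Nat.cast_one]
    omega
  have hgood : 0 < (var denVar * var denVar - 4 * get errArr (var colVar) : Expr).eval s₂ ↔
      4 * err i < L * L := by
    rw [Expr.eval_sub, Expr.eval_mul, Expr.eval_mul, Expr.eval_var, hframe₂.var (hframe₁.var hL),
      ((herr.of_frame hframe₁).of_frame hframe₂).eval_get (hframe₂.var hi), sub_pos]
    rfl
  refine Achieves.ite (fun h => ?_) fun h => ?_
  · refine Achieves.ite (fun h' => ?_) fun h' => ?_
    · exact Achieves.assign rfl (by simpa using hH₁) (by simp [heq.1 h, hgood.1 h'])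
    · exact Achieves.assign rfl (by simp) (by simp [hgood.not.1 h'.not_gt])
  · exact Achieves.assign rfl (by simp) (by simp [heq.not.1 h.not_gt])

theorem achieves_findBestRow {A : Matrix (Fin n) (Fin n) ℤ} (hn : s.var dimVar = n) (hB : n ≤ B)
    (hA : HoldsMatrix (s.arr memberArr) A) (h0 : ∀ k i, 0 ≤ A k i) (hH : ∀ k, ∑ i, A k i ≤ H) :
    Achieves H B findBestRow s fun s' => IsEmpty (Fin n) ∨
      ∃ k : Fin n, s'.var bestVar = k ∧ ∀ k', ∑ i, A k' i ≤ ∑ i, A k i := by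
  refine .of_within fun hsH => ?_
  have hnH : (n : ℤ) ≤ H := by simpa [hn] using hsH.abs_var_le dimVar
  refine (Achieves.assign (Q := fun s₁ => s₁.var sizeVar = 0) (z := 0) rfl (by simp)
    (by simp)).seq fun s₁ hframe₁ h₁ => ?_
  refine (Achieves.forTo (Inv := fun S s₂ => (S = ∅ ∧ s₂.var sizeVar = 0) ∨ ∃ k : Fin n,
    s₂.var bestVar = k ∧ s₂.var sizeVar = ∑ i, A k i ∧ ∀ k' ∈ S, ∑ i, A k' i ≤ ∑ i, A k i)
    (hframe₁.var hn) hB (by decide) (by decide) (by decide) (by simp) (Or.inl ⟨rfl, h₁⟩)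
    fun k S s₂ _ hframe₂ hk _ h₂ => ?_).mono ?_
  · have hn₂ := hframe₂.var (hframe₁.var hn)
    have hA₂ := (hA.of_frame hframe₁).of_frame hframe₂
    refine (Achieves.sumTo (z := 0) (F := A k) hn₂ hB (by decide) rfl le_rfl (h0 k)
      (by simpa using hH k) fun i s₃ hframe₃ hi =>
        (hA₂.of_frame hframe₃).eval_entry (hframe₃.var hn₂) (hframe₃.var hk) hi).seq
      fun s₃ hframe₃ hsum => ?_
    rw [zero_add] at hsum
    have hsum0 : 0 ≤ ∑ i, A k i := Finset.sum_nonneg fun i _ => h0 k i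
    have hcmp : 0 < (var accVar + 1 - var sizeVar : Expr).eval s₃ ↔
        s₂.var sizeVar ≤ ∑ i, A k i := by
      rw [Expr.eval_sub, Expr.eval_add, Expr.eval_var, Expr.eval_var, hsum, hframe₃.var rfl,
        Expr.eval_ofNat, Nat.cast_one]
      omega
    refine Achieves.ite (fun h => ?_) fun h => Achieves.skip ?_
    · refine (Achieves.assign (Q := fun s₄ => s₄.var sizeVar = ∑ i, A k i) (e := var accVar) hsum
        (by rw [abs_of_nonneg hsum0]; exact hH k) (by simp)).seq fun s₄ hframe₄ hsize => ?_
      refine Achieves.assign (e := var rowVar) (z := k) (hframe₄.var (hframe₃.var hk))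
        (by rw [Nat.abs_cast]; omega) (Or.inr ⟨k, by simp, by simpa using hsize, ?_⟩)
      obtain ⟨rfl, -⟩ | ⟨l, -, hl, hmax⟩ := h₂
      · simp
      · have hle := hl ▸ hcmp.1 h
        simpa using fun k' hk' => (hmax k' hk').trans hle
    · have hlt := not_le.1 (hcmp.not.1 h.not_gt)
      obtain ⟨-, h0⟩ | ⟨l, hl, hsize, hmax⟩ := h₂
      · omega
      · refine Or.inr ⟨l, hframe₃.var hl, hframe₃.var hsize, ?_⟩
        simpa using ⟨(hsize ▸ hlt).le, hmax⟩
  · rintro s' - (⟨h, -⟩ | ⟨k, hk, -, hmax⟩)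
    · exact Or.inl (Finset.univ_eq_empty_iff.1 h)
    · exact Or.inr ⟨k, hk, by simpa using hmax⟩

theorem achieves_outputBestRow {A : Matrix (Fin n) (Fin n) ℤ} (hn : s.var dimVar = n) (hB : n ≤ B)
    (hA : HoldsMatrix (s.arr memberArr) A) (h0 : ∀ k i, 0 ≤ A k i) (hH : ∀ k, ∑ i, A k i ≤ H) :
    Achieves H B outputBestRow s fun s' => IsEmpty (Fin n) ∨
      ∃ k : Fin n, HoldsVector (s'.arr outArr) (A k) ∧ ∀ k', ∑ i, A k' i ≤ ∑ i, A k i := by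
  refine (achieves_findBestRow hn hB hA h0 hH).seq fun s₁ hframe₁ h₁ => ?_
  have hn₁ := hframe₁.var hn
  obtain hempty | ⟨k, hk, hmax⟩ := h₁
  · exact (Achieves.fillVector (f := isEmptyElim) hn₁ hB (by decide) (by decide) isEmptyElim
      isEmptyElim).mono fun _ _ _ => Or.inl hempty
  · refine (Achieves.fillVector (f := A k) hn₁ hB (by decide) (by decide) (fun i => ?_)
      fun i s₂ _ hframe₂ hi => Achieves.skip ?_).mono fun _ _ h => Or.inr ⟨k, h, hmax⟩
    · rw [abs_of_nonneg (h0 k i)]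
      exact (Finset.single_le_sum (fun i _ => h0 k i) (Finset.mem_univ i)).trans (hH k)
    · exact ((hA.of_frame hframe₁).of_frame hframe₂).eval_entry (hframe₂.var hn₁)
        (hframe₂.var hk) hi

end Clustering

end LogRAM

/-! ## Correctness -/

namespace LogRAM

/-- Row `k` is the indicator vector of the good vertices in the cell of vertex `k`. -/
def memberMatrix {n : ℕ} (G : SimpleGraph (Fin n)) [DecidableRel G.Adj]
    (N : Matrix (Fin n) (Fin n) ℤ) (L : ℕ) (σ : Fin n → Option (Fin n)) (m : ℕ) :
    Matrix (Fin n) (Fin n) ℤ :=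
  fun k i =>
    if gridCell N σ (maxAbs N) m k = gridCell N σ (maxAbs N) m i ∧
      4 * scaledRowError G N L i < L * L then 1 else 0

theorem abs_le_maxAbs {n : ℕ} (N : Matrix (Fin n) (Fin n) ℤ) (i j : Fin n) :
    |N i j| ≤ maxAbs N := by
  rw [Int.abs_eq_natAbs]
  exact_mod_cast Finset.le_sup (f := fun c : Fin n × Fin n => (N c.1 c.2).natAbs)
    (Finset.mem_univ (i, j))

theorem exists_abs_eq_maxAbs {n : ℕ} [Nonempty (Fin n)] (N : Matrix (Fin n) (Fin n) ℤ) :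
    ∃ i j, |N i j| = maxAbs N := by
  obtain ⟨c, -, hc⟩ := Finset.exists_mem_eq_sup Finset.univ Finset.univ_nonempty
    fun c : Fin n × Fin n => (N c.1 c.2).natAbs
  exact ⟨c.1, c.2, by rw [Int.abs_eq_natAbs, maxAbs, hc]⟩

section Rational

variable {n : ℕ} {G : SimpleGraph (Fin n)} {M : Matrix (Fin n) (Fin n) ℝ}
  {N : Matrix (Fin n) (Fin n) ℤ} {L : ℕ} {σ : Fin n → Option (Fin n)}

theorem cast_scaledRowError [DecidableRel G.Adj] (hNM : ∀ i j, (N i j : ℝ) = L * M i j)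
    (i : Fin n) : (scaledRowError G N L i : ℝ) = L ^ 2 * rowError G M i := by
  have hterm (j : Fin n) : ((G.adjMatrix ℤ i j * (N i j * N i j) : ℤ) : ℝ) =
      L ^ 2 * if G.Adj i j then M i j ^ 2 else 0 := by
    rw [SimpleGraph.adjMatrix_apply]
    split_ifs
    · push_cast
      rw [hNM]
      ring
    · simp
  rw [scaledRowError, rowError, Int.cast_add, Int.cast_sum, Finset.sum_congr rfl fun j _ => hterm j,
    ← Finset.mul_sum, ← Finset.sum_filter, mul_add]
  push_cast
  rw [hNM]
  congr 1
  · ring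
  · congr!

theorem mem_goodSet_iff [DecidableRel G.Adj] (hL : 0 < L) (hNM : ∀ i j, (N i j : ℝ) = L * M i j)
    (i : Fin n) : i ∈ goodSet G M ↔ 4 * scaledRowError G N L i < L * L := by
  have hL' : (0 : ℝ) < L ^ 2 := by positivity
  rw [goodSet, Finset.mem_filter_univ, ← Int.cast_lt (R := ℝ), ← mul_lt_mul_iff_right₀ hL',
    ← cast_scaledRowError hNM]
  push_cast
  constructor <;> intro h <;> linarith

theorem cast_matrix_eq_smul (hNM : ∀ i j, (N i j : ℝ) = L * M i j) :
    N.map (Int.castRingHom ℝ) = (L : ℝ) • M := by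
  ext i j
  simpa using hNM i j

theorem isApproxSpanner_of_cast_eq (hL : 0 < L) (hNM : ∀ i j, (N i j : ℝ) = L * M i j)
    (hσ : IsApproxSpanner N σ) : IsApproxSpanner M σ := by
  have hL' : (L : ℝ) ≠ 0 := by positivity
  have h := (hσ.map (f := Int.castRingHom ℝ) Int.cast_strictMono).smul (inv_ne_zero hL')
  rwa [cast_matrix_eq_smul hNM, inv_smul_smul₀ hL'] at h

theorem gridCell_eq_spannerCell (hL : 0 < L) (hNM : ∀ i j, (N i j : ℝ) = L * M i j)
    (hσ : IsApproxSpanner N σ) (C m : ℕ) (i : Fin n) (q : RowPosition σ) :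
    gridCell N σ C m i q = spannerCell M σ (C / L) m i q := by
  obtain ⟨p, hp⟩ := Option.isSome_iff_exists.1 q.2
  have hL' : (L : ℝ) ≠ 0 := by positivity
  have hD : ((basisMatrix N σ).det : ℝ) ≠ 0 := by exact_mod_cast hσ.det_ne_zero
  have hcoord : spannerCoord M σ i q = tableau N σ i q / (basisMatrix N σ).det := by
    rw [← spannerCoord_smul hL', ← cast_matrix_eq_smul hNM, spannerCoord, tableau_map,
      det_basisMatrix_map]
    rfl
  have hM : M p i = N p i / L := by rw [hNM, mul_div_cancel_left₀ _ hL']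
  have hden : 0 ≤ 5 * C * (basisMatrix N σ).det * (basisMatrix N σ).det := by
    rw [mul_assoc]
    exact mul_nonneg (by positivity) (mul_self_nonneg _)
  rw [gridCell, hp, Option.elim_some, spannerCell, cell, basisMatrix_apply_of_some hp, hcoord, hM,
    ← Int.floor_intCast (R := ℝ) (2 * m * _ * _), ← Int.floor_div_cast_of_nonneg hden]
  congr 1
  simp only [Int.cast_mul, Int.cast_add, Int.cast_natCast, Int.cast_ofNat]
  rcases C.eq_zero_or_pos with rfl | hC
  · simp
  · field_simp

theorem gridCell_eq_iff (hL : 0 < L) (hNM : ∀ i j, (N i j : ℝ) = L * M i j)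
    (hσ : IsApproxSpanner N σ) (C m : ℕ) (i k : Fin n) :
    gridCell N σ C m i = gridCell N σ C m k ↔
      spannerCell M σ (C / L) m i = spannerCell M σ (C / L) m k := by
  simp only [funext_iff]
  refine ⟨fun h q => ?_, fun h q => ?_⟩
  · simpa only [gridCell_eq_spannerCell hL hNM hσ] using h q
  · by_cases hq : (σ q).isSome
    · simpa only [gridCell_eq_spannerCell hL hNM hσ _ _ _ ⟨q, hq⟩] using h ⟨q, hq⟩
    · simp [gridCell, Option.not_isSome_iff_eq_none.1 hq]

theorem memberMatrix_apply [DecidableRel G.Adj] (hL : 0 < L)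
    (hNM : ∀ i j, (N i j : ℝ) = L * M i j) (hσ : IsApproxSpanner N σ) (m : ℕ) (k i : Fin n) :
    memberMatrix G N L σ m k i =
      if i ∈ cellClass (goodSet G M) (spannerCell M σ (maxAbs N / L) m) k then 1 else 0 := by
  refine if_congr ?_ rfl rfl
  rw [gridCell_eq_iff hL hNM hσ, ← mem_goodSet_iff hL hNM, cellClass, Finset.mem_filter, and_comm,
    eq_comm (b := spannerCell _ _ _ _ i)]

theorem abs_le_maxAbs_div (hL : 0 < L) (hNM : ∀ i j, (N i j : ℝ) = L * M i j) (i j : Fin n) :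
    |M i j| ≤ maxAbs N / L := by
  have h : |(L : ℝ) * M i j| ≤ maxAbs N := by
    rw [← hNM]
    exact_mod_cast abs_le_maxAbs N i j
  rwa [abs_mul, Nat.abs_cast, ← le_div_iff₀' (by positivity)] at h

theorem abs_gridCell_le (hσ : IsApproxSpanner N σ) (m : ℕ) (i q : Fin n) :
    |gridCell N σ (maxAbs N) m i q| ≤ m := by
  by_cases hq : (σ q).isSome
  · have hNM (i j : Fin n) : (N i j : ℝ) = (1 : ℕ) * N.map (Int.castRingHom ℝ) i j := by simp
    rw [gridCell_eq_spannerCell one_pos hNM hσ _ _ _ ⟨q, hq⟩]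
    exact (isApproxSpanner_of_cast_eq one_pos hNM hσ).abs_spannerCell_le
      (abs_le_maxAbs_div one_pos hNM) i _
  · simp [gridCell, Option.not_isSome_iff_eq_none.1 hq]

theorem IsResolution.two_mul_add_one_le {r C m : ℕ} {c : ℝ} (h : IsResolution r C L m)
    (hL : 0 < L) (hC : (C : ℝ) ≤ c * L) (hcr : 1 ≤ c * r) :
    (2 * m + 1 : ℝ) ≤ 8 * √(c * r) := by
  have hsqrt : 1 ≤ √(c * r) := Real.one_le_sqrt.2 hcr
  obtain rfl | hlt := h.eq_one_or_lt
  · rw [Nat.cast_one]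
    linarith
  · have hL' : (0 : ℝ) < L := by positivity
    have hm : (m : ℝ) ^ 2 < 12 * (c * r) := by
      refine lt_of_mul_lt_mul_right ?_ hL'.le
      calc (m : ℝ) ^ 2 * L < 12 * r * C := by exact_mod_cast hlt
        _ ≤ 12 * r * (c * L) := by gcongr
        _ = 12 * (c * r) * L := by ring
    have hm' : (m : ℝ) ≤ 7 / 2 * √(c * r) := by
      refine abs_le_of_sq_le_sq (?_ : (m : ℝ) ^ 2 ≤ _) (by positivity) |>.trans' (le_abs_self _)
      rw [mul_pow, Real.sq_sqrt (by linarith)]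
      linarith
    linarith

theorem sum_memberMatrix [DecidableRel G.Adj] (hL : 0 < L)
    (hNM : ∀ i j, (N i j : ℝ) = L * M i j) (hσ : IsApproxSpanner N σ) (m : ℕ) (k : Fin n) :
    ∑ i, memberMatrix G N L σ m k i =
      (cellClass (goodSet G M) (spannerCell M σ (maxAbs N / L) m) k).card := by
  rw [Finset.sum_congr rfl fun i _ => memberMatrix_apply hL hNM hσ m k i, Finset.sum_boole,
    Finset.filter_univ_mem]

theorem filter_memberMatrix_eq_one [DecidableRel G.Adj] (hL : 0 < L)
    (hNM : ∀ i j, (N i j : ℝ) = L * M i j) (hσ : IsApproxSpanner N σ) (m : ℕ) (k : Fin n) :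
    ({i | memberMatrix G N L σ m k i = 1} : Finset (Fin n)) =
      cellClass (goodSet G M) (spannerCell M σ (maxAbs N / L) m) k := by
  ext i
  simp [memberMatrix_apply hL hNM hσ]

theorem maxAbs_le_mul [Nonempty (Fin n)] {c : ℝ} (hNM : ∀ i j, (N i j : ℝ) = L * M i j)
    (hM : ∀ i j, |M i j| ≤ c) : (maxAbs N : ℝ) ≤ c * L := by
  obtain ⟨i, j, hij⟩ := exists_abs_eq_maxAbs N
  rw [← Int.cast_natCast, ← hij, Int.cast_abs, hNM, abs_mul, Nat.abs_cast, mul_comm]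
  gcongr
  exact hM i j

theorem maxAbs_pos (hL : 0 < L) (hNM : ∀ i j, (N i j : ℝ) = L * M i j) (hM : 0 < M.rank) :
    0 < maxAbs N := by
  refine Nat.pos_of_ne_zero fun h0 => hM.ne' ?_
  have hzero : M = 0 := by
    ext i j
    simpa [h0] using abs_le_maxAbs_div hL hNM i j
  rw [hzero, Matrix.rank_zero]

theorem isIndepSet_and_indepBound_le [DecidableRel G.Adj] {r m : ℕ} {c ε : ℝ} {k : Fin n}
    (hL : 0 < L) (hNM : ∀ i j, (N i j : ℝ) = L * M i j) (hσ : IsApproxSpanner N σ)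
    (hm : IsResolution (Fintype.card (RowPosition σ)) (maxAbs N) L m)
    (hmax : ∀ k', ∑ i, memberMatrix G N L σ m k' i ≤ ∑ i, memberMatrix G N L σ m k i)
    (hcr : 1 ≤ c * r) (h : IsApproxCompletion G M r c ε) :
    G.IsIndepSet (({i | memberMatrix G N L σ m k i = 1} : Finset (Fin n)) : Set (Fin n)) ∧
      indepBound n r c ε ≤
        (({i | memberMatrix G N L σ m k i = 1} : Finset (Fin n)).card : ℝ) := by
  have hσM := isApproxSpanner_of_cast_eq hL hNM hσ
  have hr := (pos_of_one_le_mul_natCast hcr).2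
  have hn := h.nonempty hr
  have hL' : (0 : ℝ) < L := by positivity
  have hμ : (0 : ℝ) < maxAbs N / L :=
    div_pos (Nat.cast_pos.2 (maxAbs_pos hL hNM (h.rank_eq.symm ▸ hr))) hL'
  have hres : 3 * M.rank * (maxAbs N / L : ℝ) ≤ (m : ℝ) ^ 2 := by
    rw [hσM.rank_eq, ← mul_div_assoc, div_le_iff₀ hL']
    exact_mod_cast hm.le
  have hgrid : (2 * m + 1 : ℝ) ≤ 8 * √(c * r) := by
    rw [← h.rank_eq, hσM.rank_eq] at hcr ⊢
    exact hm.two_mul_add_one_le hL (maxAbs_le_mul hNM h.abs_le) hcr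
  rw [filter_memberMatrix_eq_one hL hNM hσ]
  refine ⟨hσM.isIndepSet_cellClass G hμ hm.pos hres k,
    hσM.indepBound_le h hcr (abs_le_maxAbs_div hL hNM) hgrid fun k' => ?_⟩
  simp only [sum_memberMatrix hL hNM hσ] at hmax
  exact_mod_cast hmax k'

end Rational

end LogRAM

namespace LogRAM

/-- Replace the input matrix by an integral multiple, and compute its largest entry. -/
def scaleInput : Prog := commonDenominator ;; clearDenominators ;; maxAbsEntry

/-- Output the largest set of good vertices in one cell. -/
def clusterVertices : Prog := computeErrors ;; computeCells ;; computeMembers ;; outputBestRow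

/-- The algorithm for finding a large independent set. -/
def indepSetProg : Prog :=
  scaleInput ;; pivotLoop ;; computeRank ;; findResolution ;; clusterVertices

section Algorithm

variable {n H B : ℕ} {s : State} {G : SimpleGraph (Fin n)} [DecidableRel G.Adj]
  {A : Matrix (Fin n) (Fin n) ℚ} {N : Matrix (Fin n) (Fin n) ℤ} {L : ℕ}
  {σ : Fin n → Option (Fin n)}

/-- A common denominator of the entries of a rational matrix. -/
def commonDen (A : Matrix (Fin n) (Fin n) ℚ) : ℕ := ∏ c : Fin n × Fin n, (A c.1 c.2).den

/-- The integral multiple `commonDen A • A` of a rational matrix. -/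
def clearDen (A : Matrix (Fin n) (Fin n) ℚ) : Matrix (Fin n) (Fin n) ℤ :=
  .of fun i j => (A i j).num * (commonDen A / (A i j).den)

/-- The memory holds the graph `G` and the rational matrix `A`. -/
structure HoldsInput (G : SimpleGraph (Fin n)) [DecidableRel G.Adj]
    (A : Matrix (Fin n) (Fin n) ℚ) (s : State) : Prop where
  dim : s.var dimVar = n
  adj : HoldsMatrix (s.arr adjArr) (G.adjMatrix ℤ)
  num : HoldsMatrix (s.arr numArr) (.of fun i j => (A i j).num)
  den : HoldsMatrix (s.arr denArr) (.of fun i j => ((A i j).den : ℤ))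

theorem commonDen_pos (A : Matrix (Fin n) (Fin n) ℚ) : 0 < commonDen A :=
  Finset.prod_pos fun _ _ => Rat.den_pos _

theorem den_dvd_commonDen (A : Matrix (Fin n) (Fin n) ℚ) (i j : Fin n) :
    (A i j).den ∣ commonDen A :=
  Finset.dvd_prod_of_mem (fun c : Fin n × Fin n => (A c.1 c.2).den) (Finset.mem_univ (i, j))

theorem cast_clearDen (A : Matrix (Fin n) (Fin n) ℚ) (i j : Fin n) :
    (clearDen A i j : ℝ) = commonDen A * (A i j : ℝ) := by
  have h0 : ((A i j).den : ℝ) ≠ 0 := by exact_mod_cast (A i j).den_nz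
  rw [clearDen, Matrix.of_apply, ← Int.natCast_div, Int.cast_mul, Int.cast_natCast,
    Nat.cast_div (den_dvd_commonDen A i j) h0, Rat.cast_def (A i j)]
  field_simp

theorem achieves_scaleInput (hB : n ≤ B) (hs : HoldsInput G A s) (hL : commonDen A ≤ H)
    (hN : ∀ i j, |clearDen A i j| ≤ H) :
    Achieves H B scaleInput s (HoldsScaledInput G (clearDen A) (commonDen A)) := by
  have hprod : ∏ c : Fin n × Fin n, ((A c.1 c.2).den : ℤ) = commonDen A :=
    (Nat.cast_prod _ _).symm
  refine (achieves_commonDenominator hs.dim hB hs.den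
    (fun i j => Nat.cast_pos.2 (A i j).den_pos) ?_).seq fun s₁ hframe₁ hden₁ => ?_
  · exact hprod.trans_le (Nat.cast_le.2 hL)
  have hden₁ : s₁.var denVar = commonDen A := hden₁.trans hprod
  refine (achieves_clearDenominators (hframe₁.var hs.dim) hB (hs.num.of_frame hframe₁)
    (hs.den.of_frame hframe₁) hden₁ hN).seq fun s₂ hframe₂ hint => ?_
  refine (achieves_maxAbsEntry (hframe₂.var (hframe₁.var hs.dim)) hB hint hN).mono
    fun s₃ hframe₃ hmax => ?_
  exact ⟨hframe₃.var (hframe₂.var (hframe₁.var hs.dim)), hframe₃.var (hframe₂.var hden₁), hmax,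
    ((hs.adj.of_frame hframe₁).of_frame hframe₂).of_frame hframe₃, hint.of_frame hframe₃⟩

theorem memberMatrix_nonneg (m : ℕ) (k i : Fin n) : 0 ≤ memberMatrix G N L σ m k i := by
  unfold memberMatrix
  split_ifs <;> norm_num

theorem memberMatrix_le_one (m : ℕ) (k i : Fin n) : memberMatrix G N L σ m k i ≤ 1 := by
  unfold memberMatrix
  split_ifs <;> norm_num

theorem achieves_clusterVertices {m : ℕ} (hB : n ≤ B) (hs : HoldsScaledInput G N L s)
    (hbasis : HoldsBasis N σ s) (hσ : IsApproxSpanner N σ) (hm : s.var resVar = m)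
    (herr : ∀ i, scaledRowError G N L i ≤ H) (hH : n * (2 * m) ^ 2 < H) :
    Achieves H B clusterVertices s fun s' => IsEmpty (Fin n) ∨
      ∃ k, HoldsVector (s'.arr outArr) (memberMatrix G N L σ m k) ∧
        ∀ k', ∑ i, memberMatrix G N L σ m k' i ≤ ∑ i, memberMatrix G N L σ m k i := by
  refine .of_within fun hsH => ?_
  have hmH : (m : ℤ) ≤ H := by simpa [hm] using hsH.abs_var_le resVar
  have hnH : (n : ℤ) ≤ H := by simpa [hs.dim] using hsH.abs_var_le dimVar
  refine (achieves_computeErrors hB hs herr).seq fun s₁ hframe₁ herr₁ => ?_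
  have hs₁ := hs.of_frame hframe₁
  refine (achieves_computeCells hB hs₁ (hbasis.of_frame hframe₁) (hframe₁.var hm)
    fun i q => (abs_gridCell_le hσ m i q).trans hmH).seq fun s₂ hframe₂ hcell₂ => ?_
  have hs₂ := hs₁.of_frame hframe₂
  refine (achieves_computeMembers hs₂.dim hB hs₂.den hcell₂ (herr₁.of_frame hframe₂)
    (abs_gridCell_le hσ m) hH).seq fun s₃ hframe₃ hmember => ?_
  refine achieves_outputBestRow (A := memberMatrix G N L σ m) (hframe₃.var hs₂.dim) hB hmember
    (memberMatrix_nonneg m) fun k => le_trans ?_ hnH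
  simpa using Finset.sum_le_card_nsmul Finset.univ _ _ fun i _ => memberMatrix_le_one m k i

theorem achieves_indepSetProg (hB : (n + 1) * (2 * H.size + 1) ≤ B) (hs : HoldsInput G A s)
    (hL : commonDen A ≤ H) (hN : ∀ i j, |clearDen A i j| ≤ H)
    (hdet : ∀ σ, |(basisMatrix (clearDen A) σ).det| ≤ H)
    (herr : ∀ i, scaledRowError G (clearDen A) (commonDen A) i ≤ H)
    (hH : n * (48 * n * maxAbs (clearDen A) + 4) < H) :
    Achieves H B indepSetProg s fun s' => ∃ σ m, IsApproxSpanner (clearDen A) σ ∧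
      IsResolution (Fintype.card (RowPosition σ)) (maxAbs (clearDen A)) (commonDen A) m ∧
      (IsEmpty (Fin n) ∨
        ∃ k, HoldsVector (s'.arr outArr) (memberMatrix G (clearDen A) (commonDen A) σ m k) ∧
          ∀ k', ∑ i, memberMatrix G (clearDen A) (commonDen A) σ m k' i ≤
            ∑ i, memberMatrix G (clearDen A) (commonDen A) σ m k i) := by
  have hnB : n ≤ B := by nlinarith
  have hsize : H.size ≤ B := by nlinarith
  refine (achieves_scaleInput hnB hs hL hN).seq fun s₁ _ h₁ => ?_
  refine (achieves_pivotLoop h₁.dim h₁.int hdet hB).seq fun s₂ hframe₂ ⟨σ, hσ, hbasis₂⟩ => ?_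
  have h₂ := h₁.of_frame hframe₂
  have hrank : Fintype.card (RowPosition σ) ≤ n :=
    (Fintype.card_subtype_le _).trans (Fintype.card_fin n).le
  refine (achieves_computeRank h₂.dim hnB hbasis₂).seq fun s₃ hframe₃ hrank₃ => ?_
  have h₃ := h₂.of_frame hframe₃
  refine (achieves_findResolution hrank₃ h₃.max h₃.den (commonDen_pos A) ?_ hsize).seq
    fun s₄ hframe₄ ⟨m, hm, hres⟩ => ?_
  · rcases n.eq_zero_or_pos with rfl | hn
    · simpa [Nat.le_zero.1 hrank] using hH
    · calc 12 * Fintype.card (RowPosition σ) * maxAbs (clearDen A)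
        _ ≤ 1 * (48 * n * maxAbs (clearDen A) + 4) := by nlinarith
        _ ≤ n * (48 * n * maxAbs (clearDen A) + 4) := by gcongr; exact hn
        _ < H := hH
  · refine (achieves_clusterVertices hnB (h₃.of_frame hframe₄)
      ((hbasis₂.of_frame hframe₃).of_frame hframe₄) hσ hm herr ?_).mono
      fun _ _ h => ⟨σ, m, hσ, hres, h⟩
    refine lt_of_le_of_lt (Nat.mul_le_mul_left n ?_) hH
    calc (2 * m) ^ 2 = 4 * m ^ 2 := by ring
      _ ≤ 4 * (12 * Fintype.card (RowPosition σ) * maxAbs (clearDen A) + 1) := by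
        gcongr
        exact hres.sq_le (commonDen_pos A)
      _ ≤ 4 * (12 * n * maxAbs (clearDen A) + 1) := by gcongr
      _ = 48 * n * maxAbs (clearDen A) + 4 := by ring

end Algorithm

end LogRAM

/-! ## Polynomial running time -/

theorem abs_basisMatrix_le {n C : ℕ} {N : Matrix (Fin n) (Fin n) ℤ} (hC : 1 ≤ C)
    (hN : ∀ i j, |N i j| ≤ C) (σ : Fin n → Option (Fin n)) (i j : Fin n) :
    |basisMatrix N σ i j| ≤ C := by
  cases h : σ i with
  | some p => simpa [basisMatrix_apply_of_some h] using hN p j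
  | none =>
    simp only [basisMatrix, Matrix.of_apply, h, Option.elim]
    split_ifs <;> simp [hC]

theorem abs_det_basisMatrix_le {n C : ℕ} {N : Matrix (Fin n) (Fin n) ℤ} (hC : 1 ≤ C)
    (hN : ∀ i j, |N i j| ≤ C) (σ : Fin n → Option (Fin n)) :
    |(basisMatrix N σ).det| ≤ (n.factorial * C ^ n : ℕ) := by
  simpa using Matrix.det_le (abv := (AbsoluteValue.abs : AbsoluteValue ℤ ℤ))
    (abs_basisMatrix_le hC hN σ)

namespace LogRAM

theorem maxAbs_le {n C : ℕ} {N : Matrix (Fin n) (Fin n) ℤ} (hN : ∀ i j, |N i j| ≤ C) :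
    maxAbs N ≤ C :=
  Finset.sup_le fun c _ => by exact_mod_cast Int.abs_eq_natAbs (N c.1 c.2) ▸ hN c.1 c.2

theorem scaledRowError_le {n C L : ℕ} (G : SimpleGraph (Fin n)) [DecidableRel G.Adj]
    {N : Matrix (Fin n) (Fin n) ℤ} (hN : ∀ i j, |N i j| ≤ C) (hL : L ≤ C) (i : Fin n) :
    scaledRowError G N L i ≤ ((n + 4) * C ^ 2 : ℕ) := by
  have hoff (j : Fin n) : G.adjMatrix ℤ i j * (N i j * N i j) ≤ (C : ℤ) ^ 2 := by
    have hsq : N i j * N i j ≤ (C : ℤ) ^ 2 := by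
      rw [← sq]
      exact sq_le_sq' (abs_le.1 (hN i j)).1 (abs_le.1 (hN i j)).2
    rw [SimpleGraph.adjMatrix_apply]
    split_ifs
    · rwa [one_mul]
    · rw [zero_mul]
      positivity
  have hsum : ∑ j, G.adjMatrix ℤ i j * (N i j * N i j) ≤ n * (C : ℤ) ^ 2 := by
    simpa using Finset.sum_le_card_nsmul Finset.univ _ _ fun j _ => hoff j
  have hdiag : (N i i - L) * (N i i - L) ≤ (2 * C : ℤ) ^ 2 := by
    obtain ⟨h₁, h₂⟩ := abs_le.1 (hN i i)
    rw [← sq]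
    exact sq_le_sq' (by omega) (by omega)
  rw [scaledRowError]
  push_cast
  linarith

theorem natAbs_lt_two_pow_of_bits_le {z : ℤ} {k : ℕ} (h : bits z ≤ k) : z.natAbs < 2 ^ k :=
  (natAbs_lt_two_pow_bits z).trans_le
    (Nat.pow_le_pow_right two_pos ((Nat.sub_le _ _).trans h))

theorem coinProb_univ (k : ℕ) : coinProb k Set.univ = 1 := by
  simp [coinProb, Set.ncard_univ]

theorem randPolyTimeSolvable_of_exec {X : Type} {size : X → ℕ}
    {load : X → (k : ℕ) → (Fin k → Bool) → State} {Valid : X → Prop} {Sol : X → State → Prop}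
    (prog : Prog) (p : Polynomial ℕ)
    (h : ∀ x k w, ∃ s t, Exec prog (load x k w) s t ∧ t ≤ p.eval (size x) ∧
      (Valid x → Sol x s)) : RandPolyTimeSolvable size load Valid Sol := by
  refine ⟨prog, p, fun x => ⟨fun w => ?_, fun hx => ?_⟩⟩
  · obtain ⟨s, t, hexec, ht, -⟩ := h x _ w
    exact ⟨s, t, hexec, ht⟩
  · have huniv : {w | ∃ s t, Exec prog (load x (p.eval (size x)) w) s t ∧ Sol x s} = Set.univ :=
      Set.eq_univ_of_forall fun w =>
        let ⟨s, t, hexec, _, hsol⟩ := h x _ w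
        ⟨s, t, hexec, hsol hx⟩
    rw [huniv, coinProb_univ]
    norm_num

end LogRAM

namespace GraphMatrixInput

open LogRAM

section Flatten

variable {n : ℕ} {A : Fin n → Fin n → ℤ}

theorem flatten_row_mul_add (i j : Fin n) : flatten A ((i : ℤ) * n + j) = A i j := by
  unfold flatten
  rw [Finset.sum_eq_single i, Finset.sum_eq_single j]
  · simp
  · exact fun j' _ hj => if_neg fun h => hj (row_mul_add_injective h).2.symm
  · simp
  · exact fun i' _ hi => Finset.sum_eq_zero fun j' _ =>
      if_neg fun h => hi (row_mul_add_injective h).1.symm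
  · simp

theorem abs_flatten_le {H : ℕ} (hA : ∀ i j, |A i j| ≤ H) (z : ℤ) : |flatten A z| ≤ H := by
  by_cases h : ∃ i j : Fin n, z = (i : ℤ) * n + j
  · obtain ⟨i, j, rfl⟩ := h
    rw [flatten_row_mul_add]
    exact hA i j
  · have hzero : flatten A z = 0 := Finset.sum_eq_zero fun i _ => Finset.sum_eq_zero fun j _ =>
      if_neg fun h' => h ⟨i, j, h'⟩
    simp [hzero]

end Flatten

variable (x : GraphMatrixInput)

theorem n_le_size : x.n ≤ x.size := by
  calc x.n ≤ x.n * x.n := Nat.le_mul_self x.n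
    _ = ∑ _i : Fin x.n, ∑ _j : Fin x.n, 1 := by simp
    _ ≤ x.size := Finset.sum_le_sum fun i _ => Finset.sum_le_sum fun j _ => by omega

theorem commonDen_le : commonDen x.M ≤ 2 ^ x.size := by
  unfold commonDen size
  rw [← Finset.prod_pow_eq_pow_sum, Fintype.prod_prod_type]
  refine Finset.prod_le_prod' fun i _ => ?_
  rw [← Finset.prod_pow_eq_pow_sum]
  refine Finset.prod_le_prod' fun j _ => ?_
  exact (natAbs_lt_two_pow_of_bits_le (z := (x.M i j).den) (Nat.le_add_left _ _)).le

theorem den_le (i j : Fin x.n) : (x.M i j).den ≤ 2 ^ x.size :=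
  (Nat.le_of_dvd (commonDen_pos x.M) (den_dvd_commonDen x.M i j)).trans x.commonDen_le

theorem abs_num_le (i j : Fin x.n) : |(x.M i j).num| ≤ (2 ^ x.size : ℕ) := by
  have hrow : ∑ j, (1 + bits (x.M i j).num + bits (x.M i j).den) ≤ x.size :=
    Finset.single_le_sum (f := fun i => ∑ j, (1 + bits (x.M i j).num + bits (x.M i j).den))
      (fun _ _ => Nat.zero_le _) (Finset.mem_univ i)
  have hentry : 1 + bits (x.M i j).num + bits (x.M i j).den ≤
      ∑ j, (1 + bits (x.M i j).num + bits (x.M i j).den) :=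
    Finset.single_le_sum (f := fun j => 1 + bits (x.M i j).num + bits (x.M i j).den)
      (fun _ _ => Nat.zero_le _) (Finset.mem_univ j)
  rw [Int.abs_eq_natAbs]
  exact Nat.cast_le.2 (natAbs_lt_two_pow_of_bits_le (by omega)).le

theorem abs_clearDen_le (i j : Fin x.n) : |clearDen x.M i j| ≤ (2 ^ (2 * x.size) : ℕ) := by
  rw [clearDen, Matrix.of_apply, abs_mul, ← Int.natCast_div, Nat.abs_cast, two_mul, pow_add,
    Nat.cast_mul]
  gcongr
  · exact x.abs_num_le i j
  · exact (Nat.div_le_self _ _).trans x.commonDen_le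

/-- A bound for the absolute values of all integers in the computation. -/
def valueBound : ℕ := 2 ^ (6 * (x.size + 1) ^ 2)

theorem size_valueBound : x.valueBound.size = 6 * (x.size + 1) ^ 2 + 1 := Nat.size_pow

theorem two_pow_le_valueBound {k : ℕ} (hk : k ≤ 6 * (x.size + 1) ^ 2) : 2 ^ k ≤ x.valueBound :=
  Nat.pow_le_pow_right two_pos hk

theorem abs_det_basisMatrix_le (σ : Fin x.n → Option (Fin x.n)) :
    |(basisMatrix (clearDen x.M) σ).det| ≤ x.valueBound := by
  refine (_root_.abs_det_basisMatrix_le Nat.one_le_two_pow x.abs_clearDen_le σ).trans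
    (Nat.cast_le.2 ?_)
  calc x.n.factorial * (2 ^ (2 * x.size)) ^ x.n
      ≤ (2 ^ x.size) ^ x.n * (2 ^ (2 * x.size)) ^ x.n := by
        gcongr
        exact (Nat.factorial_le_pow x.n).trans
          (Nat.pow_le_pow_left (x.n_le_size.trans Nat.lt_two_pow_self.le) _)
    _ = 2 ^ (3 * x.size * x.n) := by ring
    _ ≤ x.valueBound := x.two_pow_le_valueBound (by nlinarith [x.n_le_size])

theorem scaledRowError_le [DecidableRel x.G.Adj] (i : Fin x.n) :
    scaledRowError x.G (clearDen x.M) (commonDen x.M) i ≤ x.valueBound := by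
  refine (LogRAM.scaledRowError_le x.G x.abs_clearDen_le (x.commonDen_le.trans
    (Nat.pow_le_pow_right two_pos (by omega))) i).trans (Nat.cast_le.2 ?_)
  have hn : x.n < 2 ^ x.size := x.n_le_size.trans_lt Nat.lt_two_pow_self
  calc (x.n + 4) * (2 ^ (2 * x.size)) ^ 2
      ≤ (2 ^ x.size * 2 ^ 3) * (2 ^ (2 * x.size)) ^ 2 := by
        gcongr
        omega
    _ = 2 ^ (5 * x.size + 3) := by ring
    _ ≤ x.valueBound := x.two_pow_le_valueBound (by nlinarith)

theorem mul_maxAbs_lt_valueBound :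
    x.n * (48 * x.n * maxAbs (clearDen x.M) + 4) < x.valueBound := by
  have hn : x.n < 2 ^ x.size := x.n_le_size.trans_lt Nat.lt_two_pow_self
  calc x.n * (48 * x.n * maxAbs (clearDen x.M) + 4)
      < 2 ^ x.size * (48 * 2 ^ x.size * 2 ^ (2 * x.size) + 4) := by
        refine Nat.mul_lt_mul_of_lt_of_le hn ?_ (by positivity)
        gcongr
        exact maxAbs_le x.abs_clearDen_le
    _ ≤ 2 ^ x.size * (2 ^ 6 * (2 ^ x.size * 2 ^ (2 * x.size))) := by
        have hpos : 1 ≤ 2 ^ x.size * 2 ^ (2 * x.size) := Nat.one_le_iff_ne_zero.2 (by positivity)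
        gcongr
        linarith
    _ = 2 ^ (4 * x.size + 6) := by ring
    _ ≤ x.valueBound := x.two_pow_le_valueBound (by nlinarith)

theorem load_within (k : ℕ) (w : Fin k → Bool) : (x.load k w).Within x.valueBound := by
  have hone : 1 ≤ x.valueBound := Nat.one_le_two_pow
  have hsize : 2 ^ x.size ≤ x.valueBound := x.two_pow_le_valueBound (by nlinarith)
  refine ⟨fun v => ?_, fun a z => ?_⟩
  · simp only [load]
    split_ifs
    · rw [Nat.abs_cast]
      exact_mod_cast x.n_le_size.trans (Nat.lt_two_pow_self.le.trans hsize)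
    · simp
  · simp only [load]
    split
    · exact abs_flatten_le (fun i j => by split_ifs <;> simp [hone]) z
    · exact abs_flatten_le (fun i j => (x.abs_num_le i j).trans (Nat.cast_le.2 hsize)) z
    · refine abs_flatten_le (fun i j => ?_) z
      rw [Nat.abs_cast]
      exact_mod_cast (x.den_le i j).trans hsize
    · have hcard : ({l : Fin k | z = l ∧ w l = true} : Finset (Fin k)).card ≤ 1 := by
        refine Finset.card_le_one.2 fun a ha b hb => ?_
        have ha' := (Finset.mem_filter.1 ha).2.1
        have hb' := (Finset.mem_filter.1 hb).2.1
        exact Fin.ext (by omega)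
      rw [Finset.sum_boole, Nat.abs_cast]
      exact_mod_cast hcard.trans hone
    · simp

theorem load_holdsInput [DecidableRel x.G.Adj] (k : ℕ) (w : Fin k → Bool) :
    HoldsInput x.G x.M (x.load k w) where
  dim := rfl
  adj i j := by
    rw [SimpleGraph.adjMatrix_apply]
    exact (flatten_row_mul_add i j).trans (by congr)
  num i j := flatten_row_mul_add i j
  den i j := flatten_row_mul_add (A := fun i j => ((x.M i j).den : ℤ)) i j

theorem output_eq {s : State} {f : Fin x.n → ℤ} (h : HoldsVector (s.arr outArr) f) :
    x.output s = ({i | f i = 1} : Finset (Fin x.n)) :=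
  Finset.filter_congr fun i _ => by rw [← h i]

/-- A bound for the running time of the algorithm, with the size of the input as variable. -/
noncomputable def timeBound : Polynomial ℕ :=
  let valueSize : Polynomial ℕ := 6 * (.X + 1) ^ 2 + 1
  .C indepSetProg.weight * ((.X + 1) * (2 * valueSize + 1) + 1) ^ indepSetProg.depth *
    (valueSize + 1)

theorem eval_timeBound : timeBound.eval x.size =
    indepSetProg.costBound x.valueBound ((x.size + 1) * (2 * x.valueBound.size + 1)) := by
  simp [timeBound, Prog.costBound, size_valueBound]

theorem exists_exec_indepSetProg (k : ℕ) (w : Fin k → Bool) :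
    ∃ s t, Exec indepSetProg (x.load k w) s t ∧ t ≤ timeBound.eval x.size ∧
      ∀ (r : ℕ) (c ε : ℝ), 1 ≤ c * r → IsApproxCompletion x.G x.realM r c ε →
        x.G.IsIndepSet (x.output s : Set (Fin x.n)) ∧
          indepBound x.n r c ε ≤ (x.output s).card := by
  classical
  have hB : (x.n + 1) * (2 * x.valueBound.size + 1) ≤
      (x.size + 1) * (2 * x.valueBound.size + 1) := by
    gcongr
    exact x.n_le_size
  have hle {k : ℕ} (hk : k ≤ 2 * x.size) : 2 ^ k ≤ x.valueBound :=
    x.two_pow_le_valueBound (by nlinarith)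
  obtain ⟨s, t, hexec, ht, -, σ, m, hσ, hres, hout⟩ := achieves_indepSetProg hB
    (x.load_holdsInput k w) (x.commonDen_le.trans (hle (by omega)))
    (fun i j => (x.abs_clearDen_le i j).trans (Nat.cast_le.2 (hle le_rfl)))
    x.abs_det_basisMatrix_le x.scaledRowError_le x.mul_maxAbs_lt_valueBound (x.load_within k w)
  refine ⟨s, t, hexec, x.eval_timeBound ▸ ht, fun r c ε hcr h => ?_⟩
  obtain hempty | ⟨v, hv, hmax⟩ := hout
  · exact absurd (h.nonempty (pos_of_one_le_mul_natCast hcr).2) (not_nonempty_iff.2 hempty)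
  · rw [x.output_eq hv]
    exact isIndepSet_and_indepBound_le (commonDen_pos x.M) (cast_clearDen x.M) hσ hres hmax hcr h

end GraphMatrixInput

theorem lemma2p2 :
    (∀ (n r : ℕ) (c ε : ℝ) (G : SimpleGraph (Fin n)) (M : Matrix (Fin n) (Fin n) ℝ),
      1 ≤ c * r → IsApproxCompletion G M r c ε →
      ∃ T : Finset (Fin n), G.IsIndepSet (T : Set (Fin n)) ∧ indepBound n r c ε ≤ (T.card : ℝ)) ∧
    LogRAM.RandPolyTimeSolvable GraphMatrixInput.size GraphMatrixInput.load
      (fun x => ∃ (r : ℕ) (c ε : ℝ), 1 ≤ c * r ∧ IsApproxCompletion x.G x.realM r c ε)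
      (fun x s => x.G.IsIndepSet (x.output s : Set (Fin x.n)) ∧
        ∀ (r : ℕ) (c ε : ℝ), 1 ≤ c * r → IsApproxCompletion x.G x.realM r c ε →
          indepBound x.n r c ε ≤ ((x.output s).card : ℝ)) := by
  refine ⟨fun n r c ε G M hcr h => exists_isIndepSet_indepBound_le hcr h,
    LogRAM.randPolyTimeSolvable_of_exec LogRAM.indepSetProg GraphMatrixInput.timeBound
      fun x k w => ?_⟩
  obtain ⟨s, t, hexec, ht, hsol⟩ := x.exists_exec_indepSetProg k w
  exact ⟨s, t, hexec, ht, fun ⟨r, c, ε, hcr, h⟩ =>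
    ⟨(hsol r c ε hcr h).1, fun r c ε hcr h => (hsol r c ε hcr h).2⟩⟩
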